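/- Let $X$ be a connected complex manifold (Hausdorff, second countable, of finite dimension). A holomorphic vector field $\theta$ on $X$ is called completely integrable if for every $x\in X$ the initial value problem $\frac{d}{dt}\varphi(x,t)=\theta(\varphi(x,t))$, $\varphi(x,0)=x$ has a solution defined for all complex times $t\in\mathbb{C}$. The manifold $X$ is called holomorphically flexible if for every $x\in X$ the tangent space $T_xX$ is spanned over $\mathbb{C}$ by the values $\theta(x)$ of completely integrable holomorphic vector fields $\theta$ on $X$. Let $\mathrm{Aut}_{hol}(X)$ be the group of holomorphic automorphisms of $X$, and let $\mathrm{SAut}_{hol}(X)\subseteq \mathrm{Aut}_{hol}(X)$ be the subgroup generated by all holomorphic one-parameter subgroups, i.e. by the time-$t$ maps $x\mapsto\varphi(x,t)$, $t\in\mathbb{C}$, of the flows of completely integrable holomorphic vector fields. Then $\mathrm{SAut}_{hol}(X)$ acts transitively on $X$ if and only if $X$ is holomorphically flexible. In particular, if $X$ is holomorphically flexible, then $\mathrm{Aut}_{hol}(X)$ acts transitively on $X$. -/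

import Mathlib

open scoped Manifold ContDiff

/-- A vector field on the complex manifold `X` (modelled on the complex vector space `E`) is
holomorphic if it is a holomorphic (complex analytic) section of the tangent bundle. -/
def IsHolomorphicVectorField (E : Type*) [NormedAddCommGroup E] [NormedSpace ℂ E]
    {X : Type*} [TopologicalSpace X] [ChartedSpace E X] [IsManifold 𝓘(ℂ, E) ω X]
    (v : (x : X) → TangentSpace 𝓘(ℂ, E) x) : Prop :=
  ContMDiff 𝓘(ℂ, E) 𝓘(ℂ, E).tangent ω
    (fun x => (⟨x, v x⟩ : TangentBundle 𝓘(ℂ, E) X))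

/-- `φ` solves `d/dt φ(x,t) = v(φ(x,t))`, `φ(x,0) = x` for all starting points `x ∈ X` and all
complex times `t` (the derivative is the complex derivative in `t`). -/
def IsComplexFlow (E : Type*) [NormedAddCommGroup E] [NormedSpace ℂ E]
    {X : Type*} [TopologicalSpace X] [ChartedSpace E X]
    (v : (x : X) → TangentSpace 𝓘(ℂ, E) x) (φ : X → ℂ → X) : Prop :=
  ∀ x : X, φ x 0 = x ∧
    ∀ t : ℂ, HasMFDerivAt 𝓘(ℂ, ℂ) 𝓘(ℂ, E) (φ x) t
      ((1 : ℂ →L[ℂ] ℂ).smulRight (v (φ x t)))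

/-- A completely integrable holomorphic vector field: a holomorphic vector field whose integral
curves exist for all complex times and all starting points. -/
def IsCompletelyIntegrable (E : Type*) [NormedAddCommGroup E] [NormedSpace ℂ E]
    {X : Type*} [TopologicalSpace X] [ChartedSpace E X] [IsManifold 𝓘(ℂ, E) ω X]
    (v : (x : X) → TangentSpace 𝓘(ℂ, E) x) : Prop :=
  IsHolomorphicVectorField E v ∧ ∃ φ : X → ℂ → X, IsComplexFlow E v φ

/-- The point `x` is holomorphically flexible: the values at `x` of the completely integrable
holomorphic vector fields on `X` span the tangent space at `x` over `ℂ`. -/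
def IsHolomorphicallyFlexibleAt (E : Type*) [NormedAddCommGroup E] [NormedSpace ℂ E]
    {X : Type*} [TopologicalSpace X] [ChartedSpace E X] [IsManifold 𝓘(ℂ, E) ω X]
    (x : X) : Prop :=
  Submodule.span ℂ {w : TangentSpace 𝓘(ℂ, E) x |
    ∃ v : (y : X) → TangentSpace 𝓘(ℂ, E) y, IsCompletelyIntegrable E v ∧ v x = w} = ⊤

/-- The complex manifold `X` is holomorphically flexible: every point is. -/
def IsHolomorphicallyFlexible (E : Type*) [NormedAddCommGroup E] [NormedSpace ℂ E]
    (X : Type*) [TopologicalSpace X] [ChartedSpace E X] [IsManifold 𝓘(ℂ, E) ω X] : Prop :=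
  ∀ x : X, IsHolomorphicallyFlexibleAt E x

/-- The group `Aut_hol(X)` of holomorphic automorphisms (biholomorphic self-maps) of `X`, as a
group of permutations of `X`; in particular it acts on `X`. -/
def AutHol (E : Type*) [NormedAddCommGroup E] [NormedSpace ℂ E]
    (X : Type*) [TopologicalSpace X] [ChartedSpace E X] : Subgroup (Equiv.Perm X) where
  carrier := {f | ContMDiff 𝓘(ℂ, E) 𝓘(ℂ, E) ω f ∧ ContMDiff 𝓘(ℂ, E) 𝓘(ℂ, E) ω f.symm}
  mul_mem' := fun hf hg => ⟨hf.1.comp hg.1, hg.2.comp hf.2⟩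
  one_mem' := ⟨contMDiff_id, contMDiff_id⟩
  inv_mem' := fun hf => ⟨hf.2, hf.1⟩

/-- The subgroup of `Aut_hol(X)` generated by the holomorphic one-parameter subgroups, that is, by
the time-`t` maps (`t ∈ ℂ`) of the flows of completely integrable holomorphic vector fields. -/
def SAutHol (E : Type*) [NormedAddCommGroup E] [NormedSpace ℂ E]
    (X : Type*) [TopologicalSpace X] [ChartedSpace E X] [IsManifold 𝓘(ℂ, E) ω X] :
    Subgroup (AutHol E X) :=
  Subgroup.closure {g | ∃ v : (x : X) → TangentSpace 𝓘(ℂ, E) x, IsHolomorphicVectorField E v ∧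
    ∃ φ : X → ℂ → X, IsComplexFlow E v φ ∧ ∃ t : ℂ, ∀ x : X, g • x = φ x t}

open scoped Topology
open Set Filter

/-!
The flow of a completely integrable field depends holomorphically on the initial point: for small
times, because the integral form of the initial value problem is an equation in `C([0, 1], E)` to
which the analytic implicit function theorem applies, and then for all times by the group law.
Hence at a flexible point the flows of fields whose values form a basis of the tangent space
compose to a local biholomorphism from the times to `X`; so all orbits are open, and
connectedness leaves only one.

Conversely, automorphisms push completely integrable fields forward to such fields, so if the
group acts transitively, the span of their values has constant rank. Around each point, composed
flows then give coordinates that split into plaques, to which all these fields are tangent, and a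
transversal. Cover `X` by countably many such charts. By second countability a plaque meets only
countably many plaques of any other chart, so the orbit of a point, which is all of `X`, meets only
countably many plaques of each chart. Hence the transversal has dimension zero.
-/

section Superposition

variable {𝕜 K : Type*} [NontriviallyNormedField 𝕜] [TopologicalSpace K] [CompactSpace K]
  {F : Type*} [NormedAddCommGroup F] [NormedSpace 𝕜 F]

/-- The multilinear map that a continuous multilinear map `p` induces on spaces of continuous
functions by acting pointwise; these are the terms of the power series of `h ↦ f ∘ h`. -/
noncomputable def pointwiseMultilinear (K : Type*) [TopologicalSpace K] [CompactSpace K]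
    {ι : Type*} [Fintype ι] {E : ι → Type*}
    [∀ i, NormedAddCommGroup (E i)] [∀ i, NormedSpace 𝕜 (E i)]
    (p : ContinuousMultilinearMap 𝕜 E F) :
    ContinuousMultilinearMap 𝕜 (fun i => C(K, E i)) C(K, F) :=
  MultilinearMap.mkContinuous
    { toFun := fun m => ⟨fun k => p fun i => m i k, by fun_prop⟩
      map_update_add' := fun m i x y => by
        ext k
        simp [Function.apply_update (fun j (h : C(K, E j)) => h k)]
      map_update_smul' := fun m i c x => by
        ext k
        simp [Function.apply_update (fun j (h : C(K, E j)) => h k)] }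
    ‖p‖ fun m => by
      refine (ContinuousMap.norm_le _ (by positivity)).2 fun k => (p.le_opNorm _).trans ?_
      gcongr with i
      exact (m i).norm_coe_le_norm k

theorem norm_pointwiseMultilinear_le {ι : Type*} [Fintype ι] {E : ι → Type*}
    [∀ i, NormedAddCommGroup (E i)] [∀ i, NormedSpace 𝕜 (E i)]
    (p : ContinuousMultilinearMap 𝕜 E F) : ‖pointwiseMultilinear K p‖ ≤ ‖p‖ :=
  MultilinearMap.mkContinuous_norm_le _ (norm_nonneg _) _

theorem eventually_forall_apply_of_eventually {Y : Type*} [PseudoMetricSpace Y] {y₀ : Y}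
    {P : Y → Prop} (hP : ∀ᶠ y in 𝓝 y₀, P y) :
    ∀ᶠ h in 𝓝 (ContinuousMap.const K y₀), ∀ k, P (h k) := by
  obtain ⟨ε, hε, hball⟩ := Metric.eventually_nhds_iff.1 hP
  filter_upwards [Metric.ball_mem_nhds _ hε] with h hh k
  exact hball ((ContinuousMap.dist_apply_le_dist (g := .const K y₀) k).trans_lt hh)

theorem exists_analyticAt_superposition [CompleteSpace F] {E : Type*} [NormedAddCommGroup E]
    [NormedSpace 𝕜 E] {f : E → F} {z₀ : E} (hf : AnalyticAt 𝕜 f z₀) :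
    ∃ N : C(K, E) → C(K, F), AnalyticAt 𝕜 N (.const K z₀) ∧
      ∀ᶠ h in 𝓝 (.const K z₀), ∀ k, N h k = f (h k) := by
  obtain ⟨p, r, hp⟩ := hf
  let P : FormalMultilinearSeries 𝕜 C(K, E) C(K, F) := fun n => pointwiseMultilinear K (p n)
  have hradius : p.radius ≤ P.radius := by
    refine ENNReal.le_of_forall_nnreal_lt fun s hs => ?_
    obtain ⟨C, -, hC⟩ := p.norm_mul_pow_le_of_lt_radius hs
    refine P.le_radius_of_bound C fun n => le_trans ?_ (hC n)
    gcongr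
    exact norm_pointwiseMultilinear_le (p n)
  have hP := (P.hasFPowerSeriesOnBall (hp.radius_pos.trans_le hradius)).comp_sub (.const K z₀)
  rw [zero_add] at hP
  refine ⟨_, hP.analyticAt, ?_⟩
  filter_upwards [Metric.eball_mem_nhds _ hP.r_pos,
    eventually_forall_apply_of_eventually (Metric.eball_mem_nhds _ hp.r_pos)] with h hhP hhp k
  have hsum := (hP.hasSum_sub hhP).map
    (ContinuousMap.evalCLM 𝕜 k : C(K, F) →L[𝕜] F) (ContinuousMap.evalCLM 𝕜 k).continuous
  exact hsum.unique (hp.hasSum_sub (hhp k))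

end Superposition

section IntegralEquation

variable {𝕜 E : Type*} [RCLike 𝕜] [NormedAddCommGroup E] [NormedSpace 𝕜 E] [NormedSpace ℝ E]

variable (𝕜 E) in
/-- The operator `h ↦ ∫₀ h` on continuous functions on the unit interval. -/
noncomputable def unitIntervalPrimitive [SMulCommClass ℝ 𝕜 E] :
    C(unitInterval, E) →L[𝕜] C(unitInterval, E) :=
  have hcont (h : C(unitInterval, E)) :
      Continuous fun σ : ℝ => h (projIcc 0 1 zero_le_one σ) :=
    h.continuous.comp continuous_projIcc
  LinearMap.mkContinuous
    { toFun := fun h =>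
        ⟨fun τ => ∫ σ in (0 : ℝ)..τ, h (projIcc 0 1 zero_le_one σ),
          (intervalIntegral.continuous_primitive
            (fun a b => (hcont h).intervalIntegrable a b) 0).comp continuous_subtype_val⟩
      map_add' := fun g h => ContinuousMap.ext fun τ =>
        intervalIntegral.integral_add ((hcont g).intervalIntegrable _ _)
          ((hcont h).intervalIntegrable _ _)
      map_smul' := fun c h => ContinuousMap.ext fun τ => intervalIntegral.integral_smul c _ }
    1 fun h => by
      refine (ContinuousMap.norm_le _ (by positivity)).2 fun τ =>
        (intervalIntegral.norm_integral_le_of_norm_le_const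
          (fun σ _ => h.norm_coe_le_norm _)).trans ?_
      rw [sub_zero, abs_of_nonneg τ.2.1, mul_comm]
      gcongr
      exact τ.2.2

/-- The integral form of the initial value problem `γ' = t f(γ)`, `γ(0) = z` on the unit interval.
The time `t` is a parameter of the equation so that all solutions live in one Banach space. -/
def SolvesIntegralEquation (f : E → E) (z : E) (t : 𝕜) (γ : C(unitInterval, E)) : Prop :=
  ∀ τ : unitInterval, γ τ = z + t • ∫ σ in (0 : ℝ)..τ, f (γ (projIcc 0 1 zero_le_one σ))

theorem SolvesIntegralEquation.apply_zero {f : E → E} {z : E} {t : 𝕜} {γ : C(unitInterval, E)}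
    (hγ : SolvesIntegralEquation f z t γ) : γ 0 = z := by
  simpa using hγ 0

theorem SolvesIntegralEquation.hasDerivWithinAt [SMulCommClass ℝ 𝕜 E] [CompleteSpace E]
    {f : E → E} {z : E} {t : 𝕜}
    {γ : C(unitInterval, E)} (hγ : SolvesIntegralEquation f z t γ)
    (hf : ∀ τ, ContinuousAt f (γ τ)) (τ : unitInterval) :
    HasDerivWithinAt (fun σ : ℝ => γ (projIcc 0 1 zero_le_one σ)) (t • f (γ τ)) (Icc 0 1) τ := by
  have hcont : Continuous fun σ : ℝ => f (γ (projIcc 0 1 zero_le_one σ)) :=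
    continuous_iff_continuousAt.2 fun σ => ContinuousAt.comp
      (f := fun σ : ℝ => γ (projIcc 0 1 zero_le_one σ)) (hf _)
      (γ.continuous.comp continuous_projIcc).continuousAt
  have hprimitive := ((hcont.integral_hasStrictDerivAt 0 τ).hasDerivAt.const_smul t).const_add z
  rw [projIcc_val] at hprimitive
  refine hprimitive.hasDerivWithinAt.congr_of_mem (fun σ hσ => ?_) τ.2
  rw [hγ, projIcc_of_mem zero_le_one hσ]
  rfl

theorem SolvesIntegralEquation.rescale [IsScalarTower ℝ 𝕜 E] {f : E → E} {z : E} {t : 𝕜}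
    {γ : C(unitInterval, E)} (hγ : SolvesIntegralEquation f z t γ) (s : unitInterval) :
    SolvesIntegralEquation f z ((s : ℝ) • t) (γ.comp (.mulLeft s)) := by
  intro τ
  have hproj : ∀ σ ∈ uIcc (0 : ℝ) τ,
      projIcc 0 1 zero_le_one (s * σ) = s * projIcc (0 : ℝ) 1 zero_le_one σ := by
    intro σ hσ
    rw [uIcc_of_le τ.2.1] at hσ
    lift σ to unitInterval using ⟨hσ.1, hσ.2.trans τ.2.2⟩
    rw [projIcc_val]
    exact projIcc_val zero_le_one (s * σ)
  have hsubst : (s : ℝ) • ∫ σ in (0 : ℝ)..τ, f (γ (s * projIcc 0 1 zero_le_one σ)) =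
      ∫ σ in (0 : ℝ)..s * τ, f (γ (projIcc 0 1 zero_le_one σ)) := by
    rw [intervalIntegral.integral_congr fun σ hσ => congrArg (fun ρ => f (γ ρ)) (hproj σ hσ).symm]
    simpa only [mul_zero] using intervalIntegral.smul_integral_comp_mul_left (a := 0) (b := τ)
      (fun σ => f (γ (projIcc 0 1 zero_le_one σ))) (s : ℝ)
  change γ (s * τ) = z + ((s : ℝ) • t) • ∫ σ in (0 : ℝ)..τ, f (γ (s * projIcc 0 1 zero_le_one σ))
  rw [hγ (s * τ), Icc.coe_mul, ← hsubst, smul_assoc, smul_comm]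

theorem exists_contDiffAt_solvesIntegralEquation [SMulCommClass ℝ 𝕜 E] [CompleteSpace E]
    {f : E → E} {z₀ : E} (hf : AnalyticAt 𝕜 f z₀) :
    ∃ Γ : E × 𝕜 → C(unitInterval, E), ContDiffAt 𝕜 ω Γ (z₀, 0) ∧
      Γ (z₀, 0) = .const unitInterval z₀ ∧
      ∀ᶠ q in 𝓝 ((z₀, (0 : 𝕜)), ContinuousMap.const unitInterval z₀),
        SolvesIntegralEquation f q.1.1 q.1.2 q.2 ↔ Γ q.1 = q.2 := by
  obtain ⟨N, hN, hNf⟩ := exists_analyticAt_superposition (K := unitInterval) hf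
  let c : E →L[𝕜] C(unitInterval, E) := .const 𝕜 unitInterval
  let P := unitIntervalPrimitive 𝕜 E
  let S : (E × 𝕜) × C(unitInterval, E) → C(unitInterval, E) := fun q =>
    q.2 - (c q.1.1 + q.1.2 • P (N q.2))
  have hS : ContDiffAt 𝕜 ω S ((z₀, 0), c z₀) := by
    have hN' : ContDiffAt 𝕜 ω (fun q : (E × 𝕜) × C(unitInterval, E) => N q.2) ((z₀, 0), c z₀) :=
      ContDiffAt.comp _ hN.contDiffAt contDiffAt_snd
    exact contDiffAt_snd.sub ((c.contDiff.contDiffAt.comp _ contDiffAt_fst.fst).add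
      (contDiffAt_fst.snd.smul (P.contDiff.contDiffAt.comp _ hN')))
  have hS₀ : S ((z₀, 0), c z₀) = 0 := by simp [S]
  have hpartial : fderiv 𝕜 S ((z₀, 0), c z₀) ∘L .inr 𝕜 (E × 𝕜) C(unitInterval, E) = .id 𝕜 _ := by
    have hcomp := (hS.differentiableAt (by simp)).hasFDerivAt.comp (c z₀)
      (hasFDerivAt_prodMk_right (z₀, 0) (c z₀))
    refine hcomp.unique (((hasFDerivAt_id (c z₀)).sub_const (c z₀)).congr_of_eventuallyEq ?_)
    exact .of_forall fun h => by simp [S]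
  have hinv : (fderiv 𝕜 S ((z₀, 0), c z₀) ∘L .inr 𝕜 (E × 𝕜) C(unitInterval, E)).IsInvertible := by
    rw [hpartial]
    exact ⟨.refl 𝕜 _, rfl⟩
  refine ⟨hS.implicitFunction (by simp) hinv, hS.contDiffAt_implicitFunction (by simp) hinv,
    hS.implicitFunction_apply_self (by simp) hinv, ?_⟩
  filter_upwards [hS.eventually_apply_eq_iff_implicitFunction (by simp) hinv,
    continuousAt_snd.eventually hNf] with q hq hNq
  rw [← hq, hS₀, sub_eq_zero, ContinuousMap.ext_iff]
  refine forall_congr' fun τ => ?_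
  rw [← show ∫ σ in (0 : ℝ)..τ, N q.2 (projIcc 0 1 zero_le_one σ) =
    ∫ σ in (0 : ℝ)..τ, f (q.2 (projIcc 0 1 zero_le_one σ)) by simp only [hNq]]
  rfl

end IntegralEquation

section LocalFlow

variable {𝕜 E : Type*} [RCLike 𝕜] [NormedAddCommGroup E] [NormedSpace 𝕜 E] [NormedSpace ℝ E]
  [IsScalarTower ℝ 𝕜 E]

theorem SolvesIntegralEquation.smul_deriv_eq [CompleteSpace E] {f : E → E} {z : E} {t : 𝕜}
    {γ : C(unitInterval, E)} (hγ : SolvesIntegralEquation f z t γ)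
    (hf : ∀ τ, ContinuousAt f (γ τ)) {φ : 𝕜 → E}
    (hφ : ∀ s : unitInterval, φ ((s : ℝ) • t) = γ s) (s : unitInterval) {φ' : E}
    (hφ' : HasDerivAt φ φ' ((s : ℝ) • t)) : t • φ' = t • f (γ s) := by
  have hline : HasDerivAt (fun σ : ℝ => σ • t) t s := by
    simpa using (hasDerivAt_id (s : ℝ)).smul_const t
  have hcomp : HasDerivWithinAt (fun σ : ℝ => φ (σ • t)) (t • φ') (Icc 0 1) s :=
    (HasDerivAt.scomp (𝕜 := ℝ) (𝕜' := 𝕜) (h := fun σ : ℝ => σ • t) _ hφ' hline).hasDerivWithinAt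
  refine (uniqueDiffOn_Icc_zero_one s s.2).eq_deriv _ hcomp
    ((hγ.hasDerivWithinAt hf s).congr_of_mem (fun σ hσ => ?_) s.2)
  rw [projIcc_of_mem zero_le_one hσ]
  exact hφ ⟨σ, hσ⟩

/-- Both sides solve the integral equation with time `s t`, and all curves involved stay in the
neighbourhood on which the solution is unique. -/
theorem eventually_apply_smul_eq_comp_mulLeft {f : E → E} {z₀ : E}
    {Γ : E × 𝕜 → C(unitInterval, E)} (hΓ : ContinuousAt Γ (z₀, 0))
    (hΓ₀ : Γ (z₀, 0) = .const unitInterval z₀)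
    (hiff : ∀ᶠ q in 𝓝 ((z₀, (0 : 𝕜)), ContinuousMap.const unitInterval z₀),
      SolvesIntegralEquation f q.1.1 q.1.2 q.2 ↔ Γ q.1 = q.2) :
    ∀ᶠ p in 𝓝 (z₀, (0 : 𝕜)), SolvesIntegralEquation f p.1 p.2 (Γ p) ∧
      ∀ s : unitInterval, Γ (p.1, (s : ℝ) • p.2) = (Γ p).comp (.mulLeft s) := by
  obtain ⟨ε, hε, hball⟩ := Metric.eventually_nhds_iff.1 hiff
  have hΓε : ∀ᶠ p in 𝓝 (z₀, (0 : 𝕜)), dist (Γ p) (.const unitInterval z₀) < ε :=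
    hΓ₀ ▸ hΓ.eventually (Metric.ball_mem_nhds _ hε)
  filter_upwards [hΓε, Metric.ball_mem_nhds _ hε] with p hp hpε
  have hsol : SolvesIntegralEquation f p.1 p.2 (Γ p) :=
    (hball (y := (p, Γ p)) (max_lt hpε hp)).2 rfl
  refine ⟨hsol, fun s => (hball (y := ((p.1, (s : ℝ) • p.2), (Γ p).comp (.mulLeft s)))
    (max_lt (max_lt (lt_of_le_of_lt (le_max_left _ _) hpε) ?_) ?_)).1 (hsol.rescale s)⟩
  · refine lt_of_le_of_lt ?_ ((le_max_right _ _).trans_lt hpε)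
    simp only [dist_zero_right, norm_smul, Real.norm_of_nonneg s.2.1]
    exact mul_le_of_le_one_left (norm_nonneg _) s.2.2
  · refine lt_of_le_of_lt ((ContinuousMap.dist_le dist_nonneg).2 fun τ => ?_) hp
    exact ContinuousMap.dist_apply_le_dist (g := .const unitInterval z₀) (s * τ)

theorem exists_contDiffAt_flow [CompleteSpace E] {f : E → E} {z₀ : E} (hf : AnalyticAt 𝕜 f z₀) :
    ∃ Φ : E × 𝕜 → E, ContDiffAt 𝕜 ω Φ (z₀, 0) ∧ Φ (z₀, 0) = z₀ ∧
      ∀ᶠ p in 𝓝 (z₀, (0 : 𝕜)),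
        Φ (p.1, 0) = p.1 ∧ HasDerivAt (fun t => Φ (p.1, t)) (f (Φ p)) p.2 := by
  obtain ⟨Γ, hΓ, hΓ₀, hiff⟩ := exists_contDiffAt_solvesIntegralEquation hf
  have hΦ : ContDiffAt 𝕜 ω (fun p => Γ p 1) (z₀, 0) :=
    (ContinuousMap.evalCLM 𝕜 (1 : unitInterval) :
      C(unitInterval, E) →L[𝕜] E).contDiff.contDiffAt.comp _ hΓ
  refine ⟨fun p => Γ p 1, hΦ, by simp [hΓ₀], ?_⟩
  have hcont : ∀ᶠ p in 𝓝 (z₀, (0 : 𝕜)), ∀ τ, ContinuousAt f (Γ p τ) :=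
    hΓ.continuousAt.eventually (hΓ₀ ▸ eventually_forall_apply_of_eventually
      (hf.eventually_analyticAt.mono fun _ h => h.continuousAt))
  have hdiff : ∀ᶠ p in 𝓝 (z₀, (0 : 𝕜)),
      HasDerivAt (fun t => Γ (p.1, t) 1) (deriv (fun t => Γ (p.1, t) 1) p.2) p.2 := by
    filter_upwards [hΦ.eventually (by simp)] with p hp
    exact ((hp.differentiableAt (by simp)).comp (f := fun t => (p.1, t)) p.2
      (by fun_prop)).hasDerivAt
  have hgood := (eventually_apply_smul_eq_comp_mulLeft hΓ.continuousAt hΓ₀ hiff).and hcont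
  filter_upwards [hgood.eventually_nhds, hdiff] with ⟨z, t⟩ hzt hderiv
  obtain ⟨⟨hsol, hscale⟩, -⟩ := hzt.self_of_nhds
  have hzero : Γ (z, 0) 1 = z := by simpa [hsol.apply_zero] using DFunLike.congr_fun (hscale 0) 1
  refine ⟨hzero, ?_⟩
  -- A nonzero time is needed to cancel it from the rescaled equation, even when `t = 0`.
  obtain ⟨s, t', ht', rfl, ⟨hsol', hscale'⟩, hcont'⟩ : ∃ (s : unitInterval) (t' : 𝕜), t' ≠ 0 ∧
      (s : ℝ) • t' = t ∧ (SolvesIntegralEquation f z t' (Γ (z, t')) ∧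
        ∀ s : unitInterval, Γ (z, (s : ℝ) • t') = (Γ (z, t')).comp (.mulLeft s)) ∧
      ∀ τ, ContinuousAt f (Γ (z, t') τ) := by
    rcases eq_or_ne t 0 with rfl | ht
    · have hsmall : ∀ᶠ t' in 𝓝[≠] (0 : 𝕜), _ :=
        (((Continuous.prodMk_right z).tendsto 0).eventually hzt).filter_mono nhdsWithin_le_nhds
      obtain ⟨t', hgood', ht'⟩ := (hsmall.and self_mem_nhdsWithin).exists
      exact ⟨0, t', ht', by simp, hgood'⟩
    · exact ⟨1, t, ht, by simp, hzt.self_of_nhds⟩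
  have happly (s : unitInterval) : Γ (z, (s : ℝ) • t') 1 = Γ (z, t') s := by simp [hscale' s]
  convert hderiv
  rw [happly]
  exact (smul_right_injective E ht' (hsol'.smul_deriv_eq hcont' happly s hderiv)).symm

end LocalFlow

section LocalUniqueness

/-- Both curves are compared along the real segments that start at `t₀`. -/
theorem eventuallyEq_of_hasDerivAt_of_lipschitzOnWith {𝕜 E : Type*} [RCLike 𝕜]
    [NormedAddCommGroup E] [NormedSpace 𝕜 E] [NormedSpace ℝ E] [IsScalarTower ℝ 𝕜 E]
    {f : E → E} {C : NNReal} {s : Set E} (hf : LipschitzOnWith C f s) {u w : 𝕜 → E} {t₀ : 𝕜}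
    (hu : ∀ᶠ t in 𝓝 t₀, HasDerivAt u (f (u t)) t ∧ u t ∈ s)
    (hw : ∀ᶠ t in 𝓝 t₀, HasDerivAt w (f (w t)) t ∧ w t ∈ s) (h₀ : u t₀ = w t₀) :
    u =ᶠ[𝓝 t₀] w := by
  obtain ⟨ε, hε, hball⟩ := Metric.eventually_nhds_iff.1 (hu.and hw)
  filter_upwards [Metric.ball_mem_nhds _ hε] with t ht
  let line : ℝ → 𝕜 := AffineMap.lineMap t₀ t
  have hline : ∀ τ ∈ Icc (0 : ℝ) 1, dist (line τ) t₀ < ε := by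
    intro τ hτ
    rw [dist_lineMap_left, Real.norm_of_nonneg hτ.1, dist_comm]
    exact (mul_le_of_le_one_left dist_nonneg hτ.2).trans_lt ht
  have hderiv {c : 𝕜 → E} {τ : ℝ} (hc : HasDerivAt c (f (c (line τ))) (line τ)) :
      HasDerivAt (c ∘ line) ((t - t₀) • f ((c ∘ line) τ)) τ :=
    HasDerivAt.scomp (𝕜 := ℝ) (𝕜' := 𝕜) τ hc AffineMap.hasDerivAt_lineMap
  have hEqOn : EqOn (u ∘ line) (w ∘ line) (Icc 0 1) := by
    refine ODE_solution_unique_of_mem_Icc_right (v := fun _ z => (t - t₀) • f z)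
      (s := fun _ => s) (K := ‖t - t₀‖₊ * C)
      (fun _ _ => (lipschitzWith_smul (t - t₀)).comp_lipschitzOnWith hf) ?_ ?_ ?_ ?_ ?_ ?_ ?_
    · exact fun τ hτ => (hderiv (hball (hline τ hτ)).1.1).continuousAt.continuousWithinAt
    · exact fun τ hτ => (hderiv (hball (hline τ (Ico_subset_Icc_self hτ))).1.1).hasDerivWithinAt
    · exact fun τ hτ => (hball (hline τ (Ico_subset_Icc_self hτ))).1.2
    · exact fun τ hτ => (hderiv (hball (hline τ hτ)).2.1).continuousAt.continuousWithinAt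
    · exact fun τ hτ => (hderiv (hball (hline τ (Ico_subset_Icc_self hτ))).2.1).hasDerivWithinAt
    · exact fun τ hτ => (hball (hline τ (Ico_subset_Icc_self hτ))).2.2
    · simpa [line] using h₀
  simpa [line] using hEqOn (right_mem_Icc.2 zero_le_one)

end LocalUniqueness

section IntegralCurve

variable {E : Type*} [NormedAddCommGroup E] [NormedSpace ℂ E]
  {X : Type*} [TopologicalSpace X] [ChartedSpace E X]

/-- `u` is a holomorphic integral curve of `v` on the set `s` of complex times. -/
def IsComplexIntegralCurveOn (v : (x : X) → TangentSpace 𝓘(ℂ, E) x) (u : ℂ → X) (s : Set ℂ) :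
    Prop :=
  ∀ t ∈ s, HasMFDerivAt 𝓘(ℂ, ℂ) 𝓘(ℂ, E) u t ((1 : ℂ →L[ℂ] ℂ).smulRight (v (u t)))

theorem IsComplexIntegralCurveOn.continuousAt {v : (x : X) → TangentSpace 𝓘(ℂ, E) x} {u : ℂ → X}
    {s : Set ℂ} (hu : IsComplexIntegralCurveOn v u s) {t : ℂ} (ht : t ∈ s) : ContinuousAt u t :=
  (hu t ht).continuousAt

theorem IsComplexIntegralCurveOn.comp_const_add {v : (x : X) → TangentSpace 𝓘(ℂ, E) x}
    {u : ℂ → X} (hu : IsComplexIntegralCurveOn v u univ) (s : ℂ) :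
    IsComplexIntegralCurveOn v (fun t => u (s + t)) univ := fun t _ =>
  HasMFDerivAt.comp t (hu (s + t) (mem_univ _)) ((hasFDerivAt_id t).const_add s).hasMFDerivAt

variable [IsManifold 𝓘(ℂ, E) ω X] {v : (x : X) → TangentSpace 𝓘(ℂ, E) x}

/-- The expression of a vector field in the preferred chart at `x₀`, written with the coordinate
changes of the tangent bundle because holomorphy of vector fields is defined by these. -/
noncomputable def chartField (v : (x : X) → TangentSpace 𝓘(ℂ, E) x) (x₀ : X) : E → E :=
  haveI : IsManifold 𝓘(ℂ, E) 1 X := .of_le (n := ω) le_top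
  fun z => tangentCoordChange 𝓘(ℂ, E) ((extChartAt 𝓘(ℂ, E) x₀).symm z) x₀
    ((extChartAt 𝓘(ℂ, E) x₀).symm z) (v ((extChartAt 𝓘(ℂ, E) x₀).symm z))

theorem chartField_extChartAt {x₀ x : X} (hx : x ∈ (extChartAt 𝓘(ℂ, E) x₀).source) :
    chartField v x₀ (extChartAt 𝓘(ℂ, E) x₀ x) =
      mfderiv 𝓘(ℂ, E) 𝓘(ℂ, E) (extChartAt 𝓘(ℂ, E) x₀) x (v x) := by
  have : IsManifold 𝓘(ℂ, E) 1 X := .of_le (n := ω) le_top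
  have hsource : x ∈ (chartAt E x₀).source := by rwa [extChartAt_source] at hx
  rw [chartField, PartialEquiv.left_inv _ hx, (hasMFDerivAt_extChartAt hsource).mfderiv,
    mfderiv_chartAt_eq_tangentCoordChange hsource]
  rfl

theorem IsHolomorphicVectorField.contDiffAt_chartField (hv : IsHolomorphicVectorField E v)
    (x₀ : X) : ContDiffAt ℂ ω (chartField v x₀) (extChartAt 𝓘(ℂ, E) x₀ x₀) :=
  ((contMDiffAt_iff.1 (hv x₀)).2.contDiffAt (by simp)).snd

theorem hasDerivAt_extChartAt_comp {x₀ : X} {u : ℂ → X} {t : ℂ}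
    (hu : HasMFDerivAt 𝓘(ℂ, ℂ) 𝓘(ℂ, E) u t ((1 : ℂ →L[ℂ] ℂ).smulRight (v (u t))))
    (ht : u t ∈ (extChartAt 𝓘(ℂ, E) x₀).source) :
    HasDerivAt (extChartAt 𝓘(ℂ, E) x₀ ∘ u) (chartField v x₀ (extChartAt 𝓘(ℂ, E) x₀ (u t))) t := by
  have : IsManifold 𝓘(ℂ, E) 1 X := .of_le (n := ω) le_top
  have hsource : u t ∈ (chartAt E x₀).source := by rwa [extChartAt_source] at ht
  let L : E →L[ℂ] E := mfderiv 𝓘(ℂ, E) 𝓘(ℂ, E) (extChartAt 𝓘(ℂ, E) x₀) (u t)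
  let w : E := v (u t)
  have hcomp : HasFDerivAt (extChartAt 𝓘(ℂ, E) x₀ ∘ u) (L ∘L (1 : ℂ →L[ℂ] ℂ).smulRight w) t :=
    ((mdifferentiableAt_extChartAt hsource).hasMFDerivAt.comp t hu).hasFDerivAt
  refine hcomp.hasDerivAt.congr_deriv ?_
  rw [chartField_extChartAt ht]
  exact congrArg L (one_smul ℂ w)

theorem hasMFDerivAt_extChartAt_symm_comp {x₀ : X} {c : ℂ → E} {t : ℂ}
    (hc : HasDerivAt c (chartField v x₀ (c t)) t) (ht : c t ∈ (extChartAt 𝓘(ℂ, E) x₀).target) :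
    HasMFDerivAt 𝓘(ℂ, ℂ) 𝓘(ℂ, E) ((extChartAt 𝓘(ℂ, E) x₀).symm ∘ c) t
      ((1 : ℂ →L[ℂ] ℂ).smulRight (v ((extChartAt 𝓘(ℂ, E) x₀).symm (c t)))) := by
  have : IsManifold 𝓘(ℂ, E) 1 X := .of_le (n := ω) le_top
  set e := extChartAt 𝓘(ℂ, E) x₀
  have hsymm : HasMFDerivAt 𝓘(ℂ, E) 𝓘(ℂ, E) e.symm (c t)
      (mfderiv 𝓘(ℂ, E) 𝓘(ℂ, E) e.symm (c t)) := by
    have := mdifferentiableWithinAt_extChartAt_symm ht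
    rw [ModelWithCorners.range_eq_univ, mdifferentiableWithinAt_univ] at this
    exact this.hasMFDerivAt
  let A : E →L[ℂ] E := mfderiv 𝓘(ℂ, E) 𝓘(ℂ, E) e.symm (c t)
  let w : E := v (e.symm (c t))
  have hfield : A (chartField v x₀ (c t)) = w := by
    have hinv := mfderivWithin_extChartAt_symm_comp_mfderiv_extChartAt (I := 𝓘(ℂ, E)) ht
    rw [ModelWithCorners.range_eq_univ, mfderivWithin_univ] at hinv
    rw [← e.right_inv ht, chartField_extChartAt (e.map_target ht), e.right_inv ht]
    exact DFunLike.congr_fun hinv w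
  have hderiv : A ∘L .toSpanSingleton ℂ (chartField v x₀ (c t)) = (1 : ℂ →L[ℂ] ℂ).smulRight w := by
    ext
    simpa using hfield
  exact hderiv ▸ hsymm.comp t hc.hasFDerivAt.hasMFDerivAt

theorem IsHolomorphicVectorField.eventuallyEq_of_isComplexIntegralCurveOn
    (hv : IsHolomorphicVectorField E v) {u w : ℂ → X} {s : Set ℂ}
    (hu : IsComplexIntegralCurveOn v u s) (hw : IsComplexIntegralCurveOn v w s) {t₀ : ℂ}
    (hs : s ∈ 𝓝 t₀) (h₀ : u t₀ = w t₀) : u =ᶠ[𝓝 t₀] w := by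
  have : IsManifold 𝓘(ℂ, E) 1 X := .of_le (n := ω) le_top
  set e := extChartAt 𝓘(ℂ, E) (u t₀)
  obtain ⟨C, V, hV, hC⟩ :=
    ((hv.contDiffAt_chartField (u t₀)).of_le le_top : ContDiffAt ℂ 1 _ _).exists_lipschitzOnWith
  have hchart {c : ℂ → X} (hc : IsComplexIntegralCurveOn v c s) (hc₀ : c t₀ = u t₀) :
      ∀ᶠ t in 𝓝 t₀, c t ∈ e.source ∧
        HasDerivAt (e ∘ c) (chartField v (u t₀) ((e ∘ c) t)) t ∧ (e ∘ c) t ∈ V := by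
    have hcont : ContinuousAt c t₀ := hc.continuousAt (mem_of_mem_nhds hs)
    have hsource : ∀ᶠ t in 𝓝 t₀, c t ∈ e.source :=
      hcont (hc₀ ▸ extChartAt_source_mem_nhds (I := 𝓘(ℂ, E)) (u t₀))
    have hcoord : ∀ᶠ t in 𝓝 t₀, e (c t) ∈ V :=
      (ContinuousAt.comp (hc₀ ▸ continuousAt_extChartAt (u t₀)) hcont).eventually
        (by rwa [Function.comp_apply, hc₀])
    filter_upwards [hs, hsource, hcoord] with t ht hts htV
    exact ⟨hts, hasDerivAt_extChartAt_comp (hc t ht) hts, htV⟩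
  have hu' := hchart hu rfl
  have hw' := hchart hw h₀.symm
  have heq : e ∘ u =ᶠ[𝓝 t₀] e ∘ w :=
    eventuallyEq_of_hasDerivAt_of_lipschitzOnWith hC (hu'.mono fun _ h => h.2)
      (hw'.mono fun _ h => h.2) (congrArg e h₀)
  filter_upwards [hu', hw', heq] with t htu htw ht
  exact e.injOn htu.1 htw.1 ht

theorem IsHolomorphicVectorField.eqOn_of_isPreconnected [T2Space X]
    (hv : IsHolomorphicVectorField E v) {u w : ℂ → X} {s : Set ℂ} (hs : IsOpen s)
    (hs' : IsPreconnected s) (hu : IsComplexIntegralCurveOn v u s)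
    (hw : IsComplexIntegralCurveOn v w s) {t₀ : ℂ} (ht₀ : t₀ ∈ s) (h₀ : u t₀ = w t₀) :
    EqOn u w s := by
  have hlocal {t : ℂ} (ht : t ∈ s) (heq : u t = w t) : u =ᶠ[𝓝 t] w :=
    hv.eventuallyEq_of_isComplexIntegralCurveOn hu hw (hs.mem_nhds ht) heq
  have hsub : s ⊆ {t | u =ᶠ[𝓝 t] w} := by
    refine hs'.subset_of_closure_inter_subset isOpen_setOfPred_eventually_nhds
      ⟨t₀, ht₀, hlocal ht₀ h₀⟩ ?_
    rintro t ⟨htc, ht⟩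
    refine hlocal ht (tendsto_nhds_unique_of_frequently_eq (hu.continuousAt ht)
      (hw.continuousAt ht) ?_)
    exact (mem_closure_iff_frequently.1 htc).mono fun _ h => h.self_of_nhds
  exact fun t ht => (hsub ht).self_of_nhds

theorem IsHolomorphicVectorField.exists_local_flow [CompleteSpace E]
    (hv : IsHolomorphicVectorField E v) (x₀ : X) :
    ∃ Ψ : X × ℂ → X, ContMDiffAt (𝓘(ℂ, E).prod 𝓘(ℂ, ℂ)) 𝓘(ℂ, E) ω Ψ (x₀, 0) ∧
      ∀ᶠ p in 𝓝 (x₀, (0 : ℂ)), Ψ (p.1, 0) = p.1 ∧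
        HasMFDerivAt 𝓘(ℂ, ℂ) 𝓘(ℂ, E) (fun t => Ψ (p.1, t)) p.2
          ((1 : ℂ →L[ℂ] ℂ).smulRight (v (Ψ p))) := by
  set e := extChartAt 𝓘(ℂ, E) x₀
  obtain ⟨Φ, hΦ, hΦ₀, hflow⟩ := exists_contDiffAt_flow (hv.contDiffAt_chartField x₀).analyticAt
  have hcoord : ContMDiffAt (𝓘(ℂ, E).prod 𝓘(ℂ, ℂ)) (𝓘(ℂ, E).prod 𝓘(ℂ, ℂ)) ω
      (fun p : X × ℂ => (e p.1, p.2)) (x₀, 0) :=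
    (contMDiffAt_extChartAt.comp (x₀, (0 : ℂ)) contMDiffAt_fst).prodMk contMDiffAt_snd
  have hΦ' : ContMDiffAt (𝓘(ℂ, E).prod 𝓘(ℂ, ℂ)) 𝓘(ℂ, E) ω Φ (e x₀, 0) := by
    rw [← modelWithCornersSelf_prod, chartedSpaceSelf_prod]
    exact hΦ.contMDiffAt
  have htarget₀ : e.target ∈ 𝓝 (Φ (e x₀, 0)) := by
    rw [hΦ₀]
    exact extChartAt_target_mem_nhds x₀
  have hsymm : ContMDiffAt 𝓘(ℂ, E) 𝓘(ℂ, E) ω e.symm (Φ (e x₀, 0)) :=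
    (contMDiffOn_extChartAt_symm x₀).contMDiffAt htarget₀
  refine ⟨fun p => e.symm (Φ (e p.1, p.2)),
    hsymm.comp (x₀, (0 : ℂ)) (ContMDiffAt.comp (x₀, (0 : ℂ)) hΦ' hcoord), ?_⟩
  have htarget : ∀ᶠ q in 𝓝 (e x₀, (0 : ℂ)), Φ q ∈ e.target :=
    hΦ.continuousAt htarget₀
  filter_upwards [hcoord.continuousAt.eventually hflow, hcoord.continuousAt.eventually htarget,
    continuousAt_fst.preimage_mem_nhds (x := (x₀, (0 : ℂ)))
      (extChartAt_source_mem_nhds (I := 𝓘(ℂ, E)) x₀)] with p hp hpt hps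
  exact ⟨by rw [hp.1, e.left_inv hps], hasMFDerivAt_extChartAt_symm_comp hp.2 hpt⟩

end IntegralCurve

/-- A completely integrable holomorphic vector field together with its flow: `field` is the
vector field and `toFun x t` is the position at time `t` of the integral curve through `x`. -/
structure HolomorphicFlow (E : Type*) [NormedAddCommGroup E] [NormedSpace ℂ E]
    (X : Type*) [TopologicalSpace X] [ChartedSpace E X] [IsManifold 𝓘(ℂ, E) ω X] where
  field : (x : X) → TangentSpace 𝓘(ℂ, E) x
  toFun : X → ℂ → X
  isHolomorphicVectorField : IsHolomorphicVectorField E field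
  isComplexFlow : IsComplexFlow E field toFun

namespace HolomorphicFlow

variable {E : Type*} [NormedAddCommGroup E] [NormedSpace ℂ E]
  {X : Type*} [TopologicalSpace X] [ChartedSpace E X] [IsManifold 𝓘(ℂ, E) ω X]

instance : CoeFun (HolomorphicFlow E X) fun _ => X → ℂ → X := ⟨toFun⟩

variable (φ : HolomorphicFlow E X)

theorem apply_zero (x : X) : φ x 0 = x := (φ.isComplexFlow x).1

theorem isComplexIntegralCurveOn (x : X) (s : Set ℂ) :
    IsComplexIntegralCurveOn φ.field (φ x) s :=
  fun t _ => (φ.isComplexFlow x).2 t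

theorem continuous_apply (x : X) : Continuous (φ x) :=
  continuous_iff_continuousAt.2 fun t => ((φ.isComplexFlow x).2 t).continuousAt

theorem isCompletelyIntegrable_field : IsCompletelyIntegrable E φ.field :=
  ⟨φ.isHolomorphicVectorField, φ, φ.isComplexFlow⟩

variable [T2Space X]

theorem apply_add (x : X) (s t : ℂ) : φ x (s + t) = φ (φ x s) t :=
  φ.isHolomorphicVectorField.eqOn_of_isPreconnected isOpen_univ isPreconnected_univ
    ((φ.isComplexIntegralCurveOn x _).comp_const_add s) (φ.isComplexIntegralCurveOn (φ x s) _)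
    (mem_univ 0) (by simp only [add_zero, apply_zero]) (mem_univ t)

theorem contMDiffAt_add {x : X} {s t : ℂ}
    (hs : ContMDiffAt (𝓘(ℂ, E).prod 𝓘(ℂ, ℂ)) 𝓘(ℂ, E) ω (fun p : X × ℂ => φ p.1 p.2) (x, s))
    (ht : ContMDiffAt (𝓘(ℂ, E).prod 𝓘(ℂ, ℂ)) 𝓘(ℂ, E) ω (fun p : X × ℂ => φ p.1 p.2) (φ x s, t)) :
    ContMDiffAt (𝓘(ℂ, E).prod 𝓘(ℂ, ℂ)) 𝓘(ℂ, E) ω (fun p : X × ℂ => φ p.1 p.2) (x, s + t) := by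
  have hslice : ContMDiffAt (𝓘(ℂ, E).prod 𝓘(ℂ, ℂ)) 𝓘(ℂ, E) ω (fun p : X × ℂ => φ p.1 s)
      (x, s + t) :=
    ContMDiffAt.comp (x, s + t) (f := fun p : X × ℂ => (p.1, s)) hs
      (contMDiffAt_fst.prodMk contMDiffAt_const)
  have hsub : ContMDiffAt (𝓘(ℂ, E).prod 𝓘(ℂ, ℂ)) 𝓘(ℂ, ℂ) ω (fun p : X × ℂ => p.2 - s)
      (x, s + t) :=
    (contDiff_id.sub contDiff_const).contMDiff.contMDiffAt.comp (x, s + t) contMDiffAt_snd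
  have hcomp := ContMDiffAt.comp (x, s + t) (f := fun p : X × ℂ => (φ p.1 s, p.2 - s))
    (by rwa [add_sub_cancel_left]) (hslice.prodMk hsub)
  convert hcomp using 1
  funext p
  simp [← φ.apply_add]

variable [CompleteSpace E]

theorem contMDiffAt_zero (x : X) :
    ContMDiffAt (𝓘(ℂ, E).prod 𝓘(ℂ, ℂ)) 𝓘(ℂ, E) ω (fun p : X × ℂ => φ p.1 p.2) (x, 0) := by
  obtain ⟨Ψ, hΨ, hflow⟩ := φ.isHolomorphicVectorField.exists_local_flow x
  obtain ⟨U, hU, V, hV, hUV⟩ := mem_nhds_prod_iff.1 hflow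
  obtain ⟨ε, hε, hεV⟩ := Metric.mem_nhds_iff.1 hV
  refine hΨ.congr_of_eventuallyEq ?_
  filter_upwards [prod_mem_nhds hU (Metric.ball_mem_nhds 0 hε)] with ⟨y, t⟩ ⟨hy, ht⟩
  have hΨy : ∀ s ∈ Metric.ball (0 : ℂ) ε, Ψ (y, 0) = y ∧ HasMFDerivAt 𝓘(ℂ, ℂ) 𝓘(ℂ, E)
      (fun s => Ψ (y, s)) s ((1 : ℂ →L[ℂ] ℂ).smulRight (φ.field (Ψ (y, s)))) :=
    fun s hs => hUV (mk_mem_prod hy (hεV hs))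
  exact φ.isHolomorphicVectorField.eqOn_of_isPreconnected Metric.isOpen_ball
    (convex_ball 0 ε).isPreconnected (φ.isComplexIntegralCurveOn y _) (fun s hs => (hΨy s hs).2)
    (Metric.mem_ball_self hε) (by rw [φ.apply_zero, (hΨy t ht).1]) ht

protected theorem contMDiff :
    ContMDiff (𝓘(ℂ, E).prod 𝓘(ℂ, ℂ)) 𝓘(ℂ, E) ω (fun p : X × ℂ => φ p.1 p.2) := by
  rintro ⟨x, t⟩
  let S : Set ℂ := {t | ContMDiffAt (𝓘(ℂ, E).prod 𝓘(ℂ, ℂ)) 𝓘(ℂ, E) ω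
    (fun p : X × ℂ => φ p.1 p.2) (x, t)}
  have hopen : IsOpen S := isOpen_iff_mem_nhds.2 fun t ht =>
    ((Continuous.prodMk_right x).tendsto t).eventually
      ((contMDiffAt_iff_contMDiffAt_nhds (by simp)).1 ht)
  have hclosed : IsClosed S := by
    refine isClosed_of_closure_subset fun t₀ ht₀ => ?_
    have htendsto : Tendsto (fun s : ℂ => (φ x s, t₀ - s)) (𝓝 t₀) (𝓝 (φ x t₀, 0)) := by
      simpa using ((φ.continuous_apply x).prodMk (continuous_sub_left t₀)).tendsto t₀
    obtain ⟨s, hs, hst⟩ := ((mem_closure_iff_frequently.1 ht₀).and_eventually (htendsto.eventually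
      ((contMDiffAt_iff_contMDiffAt_nhds (by simp)).1 (φ.contMDiffAt_zero (φ x t₀))))).exists
    exact add_sub_cancel s t₀ ▸ φ.contMDiffAt_add hs hst
  have huniv : S = univ := IsClopen.eq_univ ⟨hclosed, hopen⟩ ⟨0, φ.contMDiffAt_zero x⟩
  exact (huniv ▸ mem_univ t : t ∈ S)

theorem contMDiff_time (t : ℂ) : ContMDiff 𝓘(ℂ, E) 𝓘(ℂ, E) ω fun x => φ x t :=
  φ.contMDiff.comp (contMDiff_id.prodMk contMDiff_const)

/-- The time-`t` map of the flow as a holomorphic automorphism. -/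
def toAutHol (t : ℂ) : AutHol E X :=
  ⟨{ toFun := fun x => φ x t
     invFun := fun x => φ x (-t)
     left_inv := fun x => by simp [← φ.apply_add, φ.apply_zero]
     right_inv := fun x => by simp [← φ.apply_add, φ.apply_zero] },
    φ.contMDiff_time t, φ.contMDiff_time (-t)⟩

theorem toAutHol_mem_SAutHol (t : ℂ) : φ.toAutHol t ∈ SAutHol E X :=
  Subgroup.subset_closure ⟨φ.field, φ.isHolomorphicVectorField, φ, φ.isComplexFlow, t, fun _ => rfl⟩

end HolomorphicFlow

section CompleteSpan

variable {E : Type*} [NormedAddCommGroup E] [NormedSpace ℂ E]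
  {X : Type*} [TopologicalSpace X] [ChartedSpace E X]

theorem AutHol.contMDiff_smul (g : AutHol E X) :
    ContMDiff 𝓘(ℂ, E) 𝓘(ℂ, E) ω (fun x : X => g • x) :=
  g.2.1

theorem AutHol.mdifferentiableAt_smul (g : AutHol E X) (x : X) :
    MDifferentiableAt 𝓘(ℂ, E) 𝓘(ℂ, E) (fun x : X => g • x) x :=
  (AutHol.contMDiff_smul g).mdifferentiableAt (by simp)

theorem AutHol.mfderiv_smul_injective (g : AutHol E X) (x : X) :
    Function.Injective (mfderiv 𝓘(ℂ, E) 𝓘(ℂ, E) (fun x : X => g • x) x) := by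
  have hcomp := (AutHol.mdifferentiableAt_smul g⁻¹ (g • x)).hasMFDerivAt.comp x
    (AutHol.mdifferentiableAt_smul g x).hasMFDerivAt
  have hid : (fun x : X => g⁻¹ • x) ∘ (fun x : X => g • x) = id :=
    funext (inv_smul_smul g)
  rw [hid] at hcomp
  exact Function.LeftInverse.injective
    (DFunLike.congr_fun (hasMFDerivAt_unique hcomp (hasMFDerivAt_id x)))

/-- The push-forward `g_* v` of a vector field under a holomorphic automorphism. The ascription to
`E` identifies the tangent spaces at `g • g⁻¹ • y` and at `y`. -/
noncomputable def AutHol.pushforward (g : AutHol E X) (v : (y : X) → TangentSpace 𝓘(ℂ, E) y) :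
    (y : X) → TangentSpace 𝓘(ℂ, E) y :=
  fun y => (mfderiv 𝓘(ℂ, E) 𝓘(ℂ, E) (fun x : X => g • x) (g⁻¹ • y) (v (g⁻¹ • y)) : E)

theorem AutHol.pushforward_apply_smul (g : AutHol E X) (v : (y : X) → TangentSpace 𝓘(ℂ, E) y)
    (x : X) :
    AutHol.pushforward g v (g • x) = mfderiv 𝓘(ℂ, E) 𝓘(ℂ, E) (fun x : X => g • x) x (v x) := by
  rw [AutHol.pushforward, inv_smul_smul]

theorem IsComplexFlow.pushforward {v : (y : X) → TangentSpace 𝓘(ℂ, E) y} {φ : X → ℂ → X}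
    (hφ : IsComplexFlow E v φ) (g : AutHol E X) :
    IsComplexFlow E (AutHol.pushforward g v) fun y t => g • φ (g⁻¹ • y) t := by
  refine fun y => ⟨by simp only [(hφ _).1, smul_inv_smul], fun t => ?_⟩
  have hcomp := (AutHol.mdifferentiableAt_smul g (φ (g⁻¹ • y) t)).hasMFDerivAt.comp t
    ((hφ (g⁻¹ • y)).2 t)
  let L : E →L[ℂ] E := mfderiv 𝓘(ℂ, E) 𝓘(ℂ, E) (fun x : X => g • x) (φ (g⁻¹ • y) t)
  refine hcomp.congr_mfderiv (ContinuousLinearMap.ext fun τ : ℂ => ?_)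
  rw [AutHol.pushforward_apply_smul]
  exact L.map_smul τ (v (φ (g⁻¹ • y) t))

variable [IsManifold 𝓘(ℂ, E) ω X]

theorem IsHolomorphicVectorField.pushforward {v : (y : X) → TangentSpace 𝓘(ℂ, E) y}
    (hv : IsHolomorphicVectorField E v) (g : AutHol E X) :
    IsHolomorphicVectorField E (AutHol.pushforward g v) := by
  have hcomp := ((AutHol.contMDiff_smul g).contMDiff_tangentMap (m := ω) le_rfl).comp
    (hv.comp (AutHol.contMDiff_smul g⁻¹))
  exact hcomp.congr fun y => Bundle.TotalSpace.ext (smul_inv_smul g y).symm HEq.rfl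

theorem IsCompletelyIntegrable.pushforward {v : (y : X) → TangentSpace 𝓘(ℂ, E) y}
    (hv : IsCompletelyIntegrable E v) (g : AutHol E X) :
    IsCompletelyIntegrable E (AutHol.pushforward g v) :=
  ⟨hv.1.pushforward g, hv.2.imp' _ fun _ hφ => hφ.pushforward g⟩

variable (E) in
/-- The subspace of `T_xX` spanned by the values of the completely integrable holomorphic vector
fields. As `x` varies, these subspaces form a distribution, possibly of varying rank. -/
noncomputable def completeSpan (x : X) : Submodule ℂ (TangentSpace 𝓘(ℂ, E) x) :=
  Submodule.span ℂ {w : TangentSpace 𝓘(ℂ, E) x |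
    ∃ v : (y : X) → TangentSpace 𝓘(ℂ, E) y, IsCompletelyIntegrable E v ∧ v x = w}

theorem IsCompletelyIntegrable.mem_completeSpan {v : (y : X) → TangentSpace 𝓘(ℂ, E) y}
    (hv : IsCompletelyIntegrable E v) (x : X) : v x ∈ completeSpan E x :=
  Submodule.subset_span ⟨v, hv, rfl⟩

theorem AutHol.mfderiv_smul_mem_completeSpan (g : AutHol E X) {x : X}
    {w : TangentSpace 𝓘(ℂ, E) x} (hw : w ∈ completeSpan E x) :
    mfderiv 𝓘(ℂ, E) 𝓘(ℂ, E) (fun x : X => g • x) x w ∈ completeSpan E (g • x) := by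
  refine (Submodule.span_le (p := (completeSpan E (g • x)).comap
    (mfderiv 𝓘(ℂ, E) 𝓘(ℂ, E) (fun x : X => g • x) x).toLinearMap)).2 ?_ hw
  rintro _ ⟨v, hv, rfl⟩
  have hmem := (hv.pushforward g).mem_completeSpan (g • x)
  rwa [AutHol.pushforward_apply_smul] at hmem

/-- The values at `x` of the vector fields of a family of flows, as vectors of the model space. -/
def fieldValues {ι : Type*} (φ : ι → HolomorphicFlow E X) (x : X) : ι → E :=
  fun i => (φ i).field x

variable [FiniteDimensional ℂ E]

theorem AutHol.finrank_completeSpan_le (g : AutHol E X) (x : X) :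
    Module.finrank ℂ (completeSpan E x) ≤ Module.finrank ℂ (completeSpan E (g • x)) := by
  have : FiniteDimensional ℂ (TangentSpace 𝓘(ℂ, E) (g • x)) :=
    inferInstanceAs (FiniteDimensional ℂ E)
  let L := (mfderiv 𝓘(ℂ, E) 𝓘(ℂ, E) (fun x : X => g • x) x).toLinearMap
  exact LinearMap.finrank_le_finrank_of_injective
    (f := L.restrict fun w hw => AutHol.mfderiv_smul_mem_completeSpan g hw)
    fun a b hab => Subtype.ext (AutHol.mfderiv_smul_injective g x (congrArg Subtype.val hab))

theorem AutHol.finrank_completeSpan_smul (g : AutHol E X) (x : X) :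
    Module.finrank ℂ (completeSpan E (g • x)) = Module.finrank ℂ (completeSpan E x) := by
  have hle := AutHol.finrank_completeSpan_le g⁻¹ (g • x)
  rw [inv_smul_smul] at hle
  exact le_antisymm hle (AutHol.finrank_completeSpan_le g x)

variable (E) in
theorem exists_flows_spanning_completeSpan (x : X) :
    ∃ φ : Fin (Module.finrank ℂ (completeSpan E x)) → HolomorphicFlow E X,
      LinearIndependent ℂ (fieldValues φ x) ∧
      Submodule.span ℂ (range (fieldValues φ x)) = completeSpan E x := by
  have : FiniteDimensional ℂ (TangentSpace 𝓘(ℂ, E) x) := inferInstanceAs (FiniteDimensional ℂ E)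
  obtain ⟨w, hw, hspan, hli⟩ := Submodule.exists_fun_fin_finrank_span_eq ℂ
    {w : TangentSpace 𝓘(ℂ, E) x |
      ∃ v : (y : X) → TangentSpace 𝓘(ℂ, E) y, IsCompletelyIntegrable E v ∧ v x = w}
  choose v hv hvw using hw
  choose hhol φ hφ using hv
  obtain rfl : (fun i => v i x) = w := funext hvw
  exact ⟨fun i => ⟨v i, φ i, hhol i, hφ i⟩, hli, hspan⟩

end CompleteSpan

section MultiFlow

variable {E : Type*} [NormedAddCommGroup E] [NormedSpace ℂ E]
  {X : Type*} [TopologicalSpace X] [ChartedSpace E X] [IsManifold 𝓘(ℂ, E) ω X]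

variable (E) in
/-- A differentiable map from a vector space to `X` whose derivative takes values in the
distribution `completeSpan`. -/
def IsTangentMap {P : Type*} [NormedAddCommGroup P] [NormedSpace ℂ P] (p : P → X) : Prop :=
  ∀ t, MDifferentiableAt 𝓘(ℂ, P) 𝓘(ℂ, E) p t ∧
    ∀ τ : P, mfderiv 𝓘(ℂ, P) 𝓘(ℂ, E) p t τ ∈ completeSpan E (p t)

theorem IsTangentMap.continuous {P : Type*} [NormedAddCommGroup P] [NormedSpace ℂ P] {p : P → X}
    (hp : IsTangentMap E p) : Continuous p :=
  continuous_iff_continuousAt.2 fun t => (hp t).1.continuousAt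

theorem HolomorphicFlow.isTangentMap (φ : HolomorphicFlow E X) (y : X) : IsTangentMap E (φ y) := by
  intro t
  have hderiv := (φ.isComplexFlow y).2 t
  refine ⟨hderiv.mdifferentiableAt, fun τ : ℂ => ?_⟩
  rw [hderiv.mfderiv]
  exact Submodule.smul_mem _ τ (φ.isCompletelyIntegrable_field.mem_completeSpan (φ y t))

variable {ι : Type*} (φ : ι → HolomorphicFlow E X) (l : List ι)

/-- The composition, along a list of indices, of the time-`t i` maps of a family of flows. The
flow of the last index is applied first. -/
def multiFlow (t : ι → ℂ) (y : X) : X :=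
  l.foldr (fun i z => φ i z (t i)) y

theorem multiFlow_cons (i : ι) (t : ι → ℂ) (y : X) :
    multiFlow φ (i :: l) t y = φ i (multiFlow φ l t y) (t i) := rfl

theorem multiFlow_zero (y : X) : multiFlow φ l 0 y = y := by
  induction l with
  | nil => rfl
  | cons i l ih => rw [multiFlow_cons, ih, Pi.zero_apply, HolomorphicFlow.apply_zero]

variable [T2Space X] [CompleteSpace E]

theorem exists_smul_eq_multiFlow (t : ι → ℂ) :
    ∃ g : SAutHol E X, ∀ y, g • y = multiFlow φ l t y := by
  induction l with
  | nil => exact ⟨1, one_smul _⟩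
  | cons i l ih =>
    obtain ⟨g, hg⟩ := ih
    refine ⟨⟨(φ i).toAutHol (t i), (φ i).toAutHol_mem_SAutHol (t i)⟩ * g, fun y => ?_⟩
    rw [mul_smul, hg]
    rfl

variable [Fintype ι]

theorem contMDiff_multiFlow :
    ContMDiff (𝓘(ℂ, ι → ℂ).prod 𝓘(ℂ, E)) 𝓘(ℂ, E) ω
      (fun p : (ι → ℂ) × X => multiFlow φ l p.1 p.2) := by
  induction l with
  | nil => exact contMDiff_snd
  | cons i l ih =>
    have hproj : ContMDiff 𝓘(ℂ, ι → ℂ) 𝓘(ℂ, ℂ) ω (fun t : ι → ℂ => t i) :=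
      (contDiff_apply ℂ ℂ i).contMDiff
    exact (φ i).contMDiff.comp (ih.prodMk (hproj.comp contMDiff_fst))

theorem contMDiff_multiFlow_left (y : X) :
    ContMDiff 𝓘(ℂ, ι → ℂ) 𝓘(ℂ, E) ω (fun t : ι → ℂ => multiFlow φ l t y) :=
  (contMDiff_multiFlow φ l).comp (contMDiff_id.prodMk contMDiff_const)

theorem mfderiv_multiFlow_cons (i : ι) (y : X) (t τ : ι → ℂ) :
    mfderiv 𝓘(ℂ, ι → ℂ) 𝓘(ℂ, E) (fun t => multiFlow φ (i :: l) t y) t τ =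
      (mfderiv 𝓘(ℂ, E) 𝓘(ℂ, E) (fun x => φ i x (t i)) (multiFlow φ l t y)
        (mfderiv 𝓘(ℂ, ι → ℂ) 𝓘(ℂ, E) (fun t => multiFlow φ l t y) t τ) +
      τ i • (φ i).field (φ i (multiFlow φ l t y) (t i)) : TangentSpace 𝓘(ℂ, E) _) := by
  have hproj : HasMFDerivAt 𝓘(ℂ, ι → ℂ) 𝓘(ℂ, ℂ) (fun t : ι → ℂ => t i) t
      (ContinuousLinearMap.proj (R := ℂ) (φ := fun _ : ι => ℂ) i) :=
    (ContinuousLinearMap.proj (R := ℂ) (φ := fun _ : ι => ℂ) i).hasFDerivAt.hasMFDerivAt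
  have htail := ((contMDiff_multiFlow_left φ l y).mdifferentiableAt (by simp)
    (x := t)).hasMFDerivAt
  have hflow : MDifferentiableAt (𝓘(ℂ, E).prod 𝓘(ℂ, ℂ)) 𝓘(ℂ, E) (fun p : X × ℂ => φ i p.1 p.2)
    (multiFlow φ l t y, t i) := (φ i).contMDiff.mdifferentiableAt (by simp)
  have hchain := (HasMFDerivAt.comp t hflow.hasMFDerivAt (htail.prodMk hproj)).mfderiv
  have htime := (((φ i).isComplexFlow (multiFlow φ l t y)).2 (t i)).mfderiv
  let w : E × ℂ := (mfderiv 𝓘(ℂ, ι → ℂ) 𝓘(ℂ, E) (fun t => multiFlow φ l t y) t τ, τ i)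
  exact (DFunLike.congr_fun hchain τ).trans <| (mfderiv_prod_eq_add_apply (v := w) hflow).trans <|
    congrArg₂ (· + ·) rfl (DFunLike.congr_fun htime (τ i))

theorem isTangentMap_multiFlow (y : X) : IsTangentMap E fun t : ι → ℂ => multiFlow φ l t y := by
  refine fun t =>
    ⟨(contMDiff_multiFlow_left φ l y).mdifferentiableAt (by simp), fun τ : ι → ℂ => ?_⟩
  induction l with
  | nil =>
    have hconst : mfderiv 𝓘(ℂ, ι → ℂ) 𝓘(ℂ, E) (fun t => multiFlow φ [] t y) t = 0 :=
      mfderiv_const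
    rw [hconst]
    exact Submodule.zero_mem _
  | cons i l ih =>
    rw [mfderiv_multiFlow_cons]
    exact Submodule.add_mem _
      (AutHol.mfderiv_smul_mem_completeSpan ((φ i).toAutHol (t i)) ih)
      (Submodule.smul_mem _ _ ((φ i).isCompletelyIntegrable_field.mem_completeSpan _))

theorem mfderiv_multiFlow_zero (y : X) (τ : ι → ℂ) :
    (mfderiv 𝓘(ℂ, ι → ℂ) 𝓘(ℂ, E) (fun t => multiFlow φ l t y) 0 τ : E) =
      (l.map fun i => τ i • fieldValues φ y i).sum := by
  induction l with
  | nil =>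
    have hconst : mfderiv 𝓘(ℂ, ι → ℂ) 𝓘(ℂ, E) (fun t => multiFlow φ [] t y) 0 = 0 :=
      mfderiv_const
    rw [hconst]
    rfl
  | cons i l ih =>
    have hid : (fun x => φ i x ((0 : ι → ℂ) i)) = id := funext (φ i).apply_zero
    have hy : φ i (multiFlow φ l 0 y) ((0 : ι → ℂ) i) = y := multiFlow_zero φ (i :: l) y
    refine (mfderiv_multiFlow_cons φ l i y 0 τ).trans ?_
    rw [hid, mfderiv_id, List.map_cons, List.sum_cons, add_comm]
    refine congrArg₂ (fun a b : E => a + b) ?_ ih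
    exact congrArg (fun z => τ i • fieldValues φ z i) hy

end MultiFlow

section InverseFunction

variable {𝕜 : Type*} [RCLike 𝕜] {P : Type*} [NormedAddCommGroup P] [NormedSpace 𝕜 P]
  {E : Type*} [NormedAddCommGroup E] [NormedSpace 𝕜 E]
  {X : Type*} [TopologicalSpace X] [ChartedSpace E X]

theorem hasMFDerivAt_iff_hasFDerivAt_extChartAt_comp {F : P → X} {p : P} {L : P →L[𝕜] E} :
    HasMFDerivAt 𝓘(𝕜, P) 𝓘(𝕜, E) F p L ↔
      ContinuousAt F p ∧ HasFDerivAt (extChartAt 𝓘(𝕜, E) (F p) ∘ F) L p := by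
  rw [← hasFDerivWithinAt_univ]
  exact (and_congr_right fun _ => by rw [ModelWithCorners.range_eq_univ]; rfl)

theorem exists_contMDiffAt_inverse [CompleteSpace P] {n : WithTop ℕ∞} (hn : n ≠ 0)
    [IsManifold 𝓘(𝕜, E) n X]
    {F : P → X} {p : P} (hF : ContMDiffAt 𝓘(𝕜, P) 𝓘(𝕜, E) n F p)
    (A : P ≃L[𝕜] E) (hA : mfderiv 𝓘(𝕜, P) 𝓘(𝕜, E) F p = A.toContinuousLinearMap) :
    ∃ ψ : X → P, ContMDiffAt 𝓘(𝕜, E) 𝓘(𝕜, P) n ψ (F p) ∧ ψ (F p) = p ∧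
      (∀ᶠ q in 𝓝 p, ψ (F q) = q) ∧ ∀ᶠ y in 𝓝 (F p), F (ψ y) = y := by
  set e := extChartAt 𝓘(𝕜, E) (F p)
  have hderiv : HasFDerivAt (e ∘ F) (A : P →L[𝕜] E) p :=
    (hasMFDerivAt_iff_hasFDerivAt_extChartAt_comp.1
      (hA ▸ (hF.mdifferentiableAt hn).hasMFDerivAt)).2
  have hsmooth : ContDiffAt 𝕜 n (e ∘ F) p := (contMDiffAt_extChartAt.comp p hF).contDiffAt
  let θ := hsmooth.localInverse hderiv hn
  have hθ : ContDiffAt 𝕜 n θ (e (F p)) := hsmooth.to_localInverse hderiv hn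
  have hθp : θ (e (F p)) = p := hsmooth.localInverse_apply_image hderiv hn
  have hstrict := hsmooth.hasStrictFDerivAt' hderiv hn
  have hψ : ContMDiffAt 𝓘(𝕜, E) 𝓘(𝕜, P) n (θ ∘ e) (F p) :=
    hθ.contMDiffAt.comp (F p) contMDiffAt_extChartAt
  refine ⟨θ ∘ e, hψ, hθp, hstrict.eventually_left_inverse, ?_⟩
  have hcont : ContinuousAt (F ∘ θ ∘ e) (F p) :=
    ContinuousAt.comp (by simpa only [Function.comp_apply, hθp] using hF.continuousAt)
      hψ.continuousAt
  have hsource : e.source ∈ 𝓝 (F (θ (e (F p)))) := by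
    rw [hθp]
    exact extChartAt_source_mem_nhds (F p)
  filter_upwards [(continuousAt_extChartAt (F p)).eventually hstrict.eventually_right_inverse,
    hcont.eventually hsource, extChartAt_source_mem_nhds (I := 𝓘(𝕜, E)) (F p)] with y hright hFy hy
  exact e.injOn hFy hy hright

end InverseFunction

section FlowBox

variable {E : Type*} [NormedAddCommGroup E] [NormedSpace ℂ E]
  {X : Type*} [TopologicalSpace X] [ChartedSpace E X] (x : X) (W : Submodule ℂ E)

/-- The slice through `x` in the directions `W`, obtained by translation in the preferred chart
at `x`. It is meaningful only for small `w`, where the translate stays in the chart. -/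
noncomputable def chartSlice (w : W) : X :=
  (extChartAt 𝓘(ℂ, E) x).symm (extChartAt 𝓘(ℂ, E) x x + w)

theorem chartSlice_zero : chartSlice x W 0 = x := by
  simp [chartSlice]

theorem hasMFDerivAt_chartSlice_zero :
    HasMFDerivAt 𝓘(ℂ, W) 𝓘(ℂ, E) (chartSlice x W) 0 W.subtypeL := by
  set e := extChartAt 𝓘(ℂ, E) x
  have htranslate : HasFDerivAt (fun w : W => e x + w) W.subtypeL 0 :=
    W.subtypeL.hasFDerivAt.const_add _
  have htendsto : Tendsto (fun w : W => e x + w) (𝓝 0) (𝓝 (e x)) := by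
    simpa using htranslate.continuousAt.tendsto
  have hcont : ContinuousAt (chartSlice x W) 0 :=
    ContinuousAt.comp (g := e.symm)
      (by rw [ZeroMemClass.coe_zero, add_zero]; exact continuousAt_extChartAt_symm x)
      htranslate.continuousAt
  refine hasMFDerivAt_iff_hasFDerivAt_extChartAt_comp.2 ⟨hcont, ?_⟩
  refine htranslate.congr_of_eventuallyEq ?_
  filter_upwards [htendsto.eventually (extChartAt_target_mem_nhds x)] with w hw
  simp only [Function.comp_apply, chartSlice_zero]
  exact e.right_inv hw

variable [IsManifold 𝓘(ℂ, E) ω X]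

theorem contMDiffAt_chartSlice_zero : ContMDiffAt 𝓘(ℂ, W) 𝓘(ℂ, E) ω (chartSlice x W) 0 := by
  have hsymm : ContMDiffAt 𝓘(ℂ, E) 𝓘(ℂ, E) ω (extChartAt 𝓘(ℂ, E) x).symm
      (extChartAt 𝓘(ℂ, E) x x + ((0 : W) : E)) := by
    rw [ZeroMemClass.coe_zero, add_zero]
    exact (contMDiffOn_extChartAt_symm x).contMDiffAt (extChartAt_target_mem_nhds x)
  exact hsymm.comp (0 : W) (contDiff_const.add W.subtypeL.contDiff).contDiffAt.contMDiffAt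

variable {ι : Type*} [Fintype ι] (φ : ι → HolomorphicFlow E X)

/-- The coordinates around `x` given by a finite family of flows and a slice transversal to them:
starting from the point `w` of the slice, follow the `i`-th flow for time `t i`. -/
noncomputable def flowBox (p : (ι → ℂ) × W) : X :=
  multiFlow φ Finset.univ.toList p.1 (chartSlice x W p.2)

theorem flowBox_zero_left (w : W) : flowBox x W φ (0, w) = chartSlice x W w :=
  multiFlow_zero φ _ _

theorem flowBox_zero : flowBox x W φ 0 = x :=
  (flowBox_zero_left x W φ 0).trans (chartSlice_zero x W)

variable {x W φ} in
theorem mfderiv_flowBox_left {p : (ι → ℂ) × W}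
    (hp : MDifferentiableAt 𝓘(ℂ, (ι → ℂ) × W) 𝓘(ℂ, E) (flowBox x W φ) p) (τ : ι → ℂ) :
    (mfderiv 𝓘(ℂ, (ι → ℂ) × W) 𝓘(ℂ, E) (flowBox x W φ) p (τ, (0 : W)) : E) =
      mfderiv 𝓘(ℂ, ι → ℂ) 𝓘(ℂ, E)
        (fun t => multiFlow φ Finset.univ.toList t (chartSlice x W p.2)) p.1 τ := by
  have hcomp := HasMFDerivAt.comp (f := fun t : ι → ℂ => (t, p.2)) p.1 hp.hasMFDerivAt
    (hasFDerivAt_prodMk_left p.1 p.2).hasMFDerivAt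
  exact (DFunLike.congr_fun hcomp.mfderiv τ).symm

variable {x W φ} in
theorem snd_image_mem_nhds_zero_of_inverse_flowBox
    {ψ : X → (ι → ℂ) × W} (hleft : ∀ᶠ p in 𝓝 0, ψ (flowBox x W φ p) = p)
    {U : Set X} (hU : U ∈ 𝓝 x) :
    (fun y => (ψ y).2) '' U ∈ 𝓝 0 := by
  have hslice : Tendsto (chartSlice x W) (𝓝 0) (𝓝 x) := by
    simpa only [chartSlice_zero] using (contMDiffAt_chartSlice_zero x W).continuousAt.tendsto
  have hembed : Tendsto (fun w : W => ((0 : ι → ℂ), w)) (𝓝 0) (𝓝 0) :=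
    (Continuous.prodMk_right (0 : ι → ℂ)).tendsto 0
  filter_upwards [hembed.eventually hleft, hslice.eventually hU] with w hw hwU
  rw [flowBox_zero_left] at hw
  exact ⟨chartSlice x W w, hwU, congrArg Prod.snd hw⟩

variable [T2Space X] [CompleteSpace E]

theorem contMDiffAt_flowBox_zero :
    ContMDiffAt 𝓘(ℂ, (ι → ℂ) × W) 𝓘(ℂ, E) ω (flowBox x W φ) 0 := by
  have hslice : ContMDiffAt 𝓘(ℂ, (ι → ℂ) × W) 𝓘(ℂ, E) ω
      (fun p : (ι → ℂ) × W => chartSlice x W p.2) 0 :=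
    ContMDiffAt.comp (0 : (ι → ℂ) × W) (g := chartSlice x W) (contMDiffAt_chartSlice_zero x W)
      contDiffAt_snd.contMDiffAt
  exact (contMDiff_multiFlow φ _).contMDiffAt.comp (0 : (ι → ℂ) × W)
    (contDiffAt_fst.contMDiffAt.prodMk hslice)

variable {x W φ} in
theorem mfderiv_flowBox_mem_completeSpan {p : (ι → ℂ) × W}
    (hp : MDifferentiableAt 𝓘(ℂ, (ι → ℂ) × W) 𝓘(ℂ, E) (flowBox x W φ) p) (τ : ι → ℂ) :
    mfderiv 𝓘(ℂ, (ι → ℂ) × W) 𝓘(ℂ, E) (flowBox x W φ) p (τ, (0 : W)) ∈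
      completeSpan E (flowBox x W φ p) :=
  (congrArg (· ∈ completeSpan E (flowBox x W φ p)) (mfderiv_flowBox_left hp τ)).mpr
    ((isTangentMap_multiFlow φ Finset.univ.toList (chartSlice x W p.2) p.1).2 τ)

theorem mfderiv_flowBox_zero (τ : ι → ℂ) (w : W) :
    (mfderiv 𝓘(ℂ, (ι → ℂ) × W) 𝓘(ℂ, E) (flowBox x W φ) 0 (τ, w) : E) =
      ∑ i, τ i • fieldValues φ x i + (w : E) := by
  have hdiff := (contMDiffAt_flowBox_zero x W φ).mdifferentiableAt (by simp)
  let A : (ι → ℂ) × W →L[ℂ] E := mfderiv 𝓘(ℂ, (ι → ℂ) × W) 𝓘(ℂ, E) (flowBox x W φ) 0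
  have hflow : A (τ, 0) = ∑ i, τ i • fieldValues φ x i := by
    have hzero := mfderiv_multiFlow_zero φ Finset.univ.toList (chartSlice x W 0) τ
    rw [Finset.sum_map_toList] at hzero
    refine ((mfderiv_flowBox_left hdiff τ).trans hzero).trans ?_
    rw [chartSlice_zero]
  have hslice : A (0, w) = w := by
    have hcomp := HasMFDerivAt.comp (f := fun w : W => ((0 : ι → ℂ), w)) (0 : W)
      hdiff.hasMFDerivAt (hasFDerivAt_prodMk_right 0 0).hasMFDerivAt
    have heq : flowBox x W φ ∘ (fun w : W => ((0 : ι → ℂ), w)) = chartSlice x W :=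
      funext (flowBox_zero_left x W φ)
    rw [heq] at hcomp
    exact DFunLike.congr_fun (hasMFDerivAt_unique hcomp (hasMFDerivAt_chartSlice_zero x W)) w
  have hsum : ((τ, w) : (ι → ℂ) × W) = (τ, 0) + (0, w) := by simp
  exact (congrArg A hsum).trans ((map_add A _ _).trans (congrArg₂ (· + ·) hflow hslice))

variable {x W φ} in
theorem exists_inverse_flowBox [FiniteDimensional ℂ E]
    (hli : LinearIndependent ℂ (fieldValues φ x))
    (hW : IsCompl (Submodule.span ℂ (range (fieldValues φ x))) W) :
    ∃ ψ : X → (ι → ℂ) × W, ContMDiffAt 𝓘(ℂ, E) 𝓘(ℂ, (ι → ℂ) × W) ω ψ x ∧ ψ x = 0 ∧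
      (∀ᶠ p in 𝓝 0, ψ (flowBox x W φ p) = p) ∧ ∀ᶠ y in 𝓝 x, flowBox x W φ (ψ y) = y := by
  let A : ((ι → ℂ) × W) ≃L[ℂ] E :=
    (((Module.Basis.span hli).equivFun.symm.prodCongr (.refl ℂ W)).trans
      (Submodule.prodEquivOfIsCompl _ W hW)).toContinuousLinearEquiv
  have hA (τ : ι → ℂ) (w : W) : A (τ, w) = ∑ i, τ i • fieldValues φ x i + (w : E) := by
    simp [A, Module.Basis.equivFun_symm_apply, Module.Basis.span_apply]
  have hderiv : mfderiv 𝓘(ℂ, (ι → ℂ) × W) 𝓘(ℂ, E) (flowBox x W φ) 0 = A.toContinuousLinearMap :=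
    ContinuousLinearMap.ext fun q => (mfderiv_flowBox_zero x W φ q.1 q.2).trans (hA q.1 q.2).symm
  obtain ⟨ψ, hψ, hψ₀, hleft, hright⟩ :=
    exists_contMDiffAt_inverse (by simp) (contMDiffAt_flowBox_zero x W φ) A hderiv
  rw [flowBox_zero] at hψ hψ₀ hright
  exact ⟨ψ, hψ, hψ₀, hleft, hright⟩

end FlowBox

section Flexible

variable {E : Type*} [NormedAddCommGroup E] [NormedSpace ℂ E] [FiniteDimensional ℂ E]
  {X : Type*} [TopologicalSpace X] [T2Space X] [ChartedSpace E X] [IsManifold 𝓘(ℂ, E) ω X]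

theorem IsHolomorphicallyFlexibleAt.orbit_mem_nhds {x : X}
    (hx : IsHolomorphicallyFlexibleAt E x) : MulAction.orbit (SAutHol E X) x ∈ 𝓝 x := by
  have : CompleteSpace E := FiniteDimensional.complete ℂ E
  obtain ⟨φ, hli, hspan⟩ := exists_flows_spanning_completeSpan E x
  have hcompl : IsCompl (Submodule.span ℂ (range (fieldValues φ x))) ⊥ :=
    (hspan.trans hx : Submodule.span ℂ (range (fieldValues φ x)) = ⊤) ▸ isCompl_top_bot
  obtain ⟨ψ, -, -, -, hright⟩ := exists_inverse_flowBox hli hcompl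
  filter_upwards [hright] with y hy
  obtain ⟨g, hg⟩ := exists_smul_eq_multiFlow φ Finset.univ.toList (ψ y).1
  have hslice : (ψ y).2 = 0 := Subsingleton.elim _ _
  rw [flowBox, hslice, chartSlice_zero, ← hg] at hy
  exact ⟨g, hy⟩

theorem IsHolomorphicallyFlexible.isPretransitive_SAutHol [ConnectedSpace X]
    (hX : IsHolomorphicallyFlexible E X) : MulAction.IsPretransitive (SAutHol E X) X := by
  have hopen : ∀ x : X, IsOpen (MulAction.orbit (SAutHol E X) x) := fun x =>
    isOpen_iff_mem_nhds.2 fun y hy => MulAction.orbit_eq_iff.2 hy ▸ (hX y).orbit_mem_nhds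
  refine ⟨fun x y => ?_⟩
  -- The complement of an orbit is a union of orbits.
  have hclosed : IsClosed (MulAction.orbit (SAutHol E X) x) := by
    refine ⟨isOpen_iff_mem_nhds.2 fun z hz => ?_⟩
    filter_upwards [(hopen z).mem_nhds (MulAction.mem_orbit_self z)] with w hwz hwx
    exact hz (MulAction.orbit_eq_iff.1
      ((MulAction.orbit_eq_iff.2 hwz).symm.trans (MulAction.orbit_eq_iff.2 hwx)))
  have huniv : MulAction.orbit (SAutHol E X) x = univ :=
    IsClopen.eq_univ ⟨hclosed, hopen x⟩ ⟨x, MulAction.mem_orbit_self x⟩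
  exact (huniv ▸ mem_univ y : y ∈ MulAction.orbit (SAutHol E X) x)

end Flexible

section ZeroDerivative

variable {𝕜 : Type*} [RCLike 𝕜] {T F : Type*} [NormedAddCommGroup T] [NormedSpace 𝕜 T]
  [NormedAddCommGroup F] [NormedSpace 𝕜 F] {f : T → F}

theorem eventually_eq_of_hasFDerivAt_zero {t₀ : T}
    (hf : ∀ᶠ t in 𝓝 t₀, HasFDerivAt f (0 : T →L[𝕜] F) t) : ∀ᶠ t in 𝓝 t₀, f t = f t₀ := by
  let _ : NormedSpace ℝ T := NormedSpace.restrictScalars ℝ 𝕜 T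
  obtain ⟨ε, hε, hball⟩ := Metric.eventually_nhds_iff_ball.1 hf
  filter_upwards [Metric.ball_mem_nhds t₀ hε] with t ht
  exact Metric.isOpen_ball.is_const_of_fderiv_eq_zero (𝕜 := 𝕜) (convex_ball t₀ ε).isPreconnected
    (fun s hs => (hball s hs).differentiableAt.differentiableWithinAt)
    (fun s hs => (hball s hs).fderiv) ht (Metric.mem_ball_self hε)

theorem countable_image_of_hasFDerivAt_zero [SecondCountableTopology T] {O : Set T}
    (hO : IsOpen O) (hf : ∀ t ∈ O, HasFDerivAt f (0 : T →L[𝕜] F) t) : (f '' O).Countable := by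
  have hloc : ∀ t ∈ O, {s | f s = f t} ∈ 𝓝[O] t := fun t ht => mem_nhdsWithin_of_mem_nhds
    (eventually_eq_of_hasFDerivAt_zero ((hO.eventually_mem ht).mono hf))
  obtain ⟨S, -, hS, hcover⟩ := TopologicalSpace.countable_cover_nhdsWithin hloc
  refine (hS.image f).mono (image_subset_iff.2 fun t ht => ?_)
  obtain ⟨s, hs, hts⟩ := mem_iUnion₂.1 (hcover ht)
  exact ⟨s, hs, Eq.symm hts⟩

end ZeroDerivative

section FoliatedChart

variable {E : Type*} [NormedAddCommGroup E] [NormedSpace ℂ E]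
  {X : Type*} [TopologicalSpace X] [ChartedSpace E X] [IsManifold 𝓘(ℂ, E) ω X]

variable (E X) in
/-- An open set `source` with a transversal coordinate `coord` which is constant along the
distribution `completeSpan`; the fibres of `coord`, the plaques of the chart, are each covered by a
single tangent map. The values of `coord` outside `source` are irrelevant. -/
structure FoliatedChart where
  source : Set X
  transversal : Submodule ℂ E
  coord : X → transversal
  isOpen_source : IsOpen source
  mdifferentiableAt_coord : ∀ y ∈ source, MDifferentiableAt 𝓘(ℂ, E) 𝓘(ℂ, transversal) coord y
  mfderiv_coord_eq_zero : ∀ y ∈ source, ∀ w ∈ completeSpan E y,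
    mfderiv 𝓘(ℂ, E) 𝓘(ℂ, transversal) coord y w = 0
  exists_isTangentMap : ∀ w : transversal, ∃ (n : ℕ) (p : (Fin n → ℂ) → X), IsTangentMap E p ∧
    source ∩ coord ⁻¹' {w} ⊆ range p

section TangentMap

variable {P : Type*} [NormedAddCommGroup P] [NormedSpace ℂ P] {p : P → X}

theorem FoliatedChart.hasFDerivAt_coord_comp (c : FoliatedChart E X) (hp : IsTangentMap E p)
    {t : P} (ht : p t ∈ c.source) : HasFDerivAt (c.coord ∘ p) (0 : P →L[ℂ] c.transversal) t := by
  have hcomp := (c.mdifferentiableAt_coord _ ht).hasMFDerivAt.comp t (hp t).1.hasMFDerivAt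
  exact HasMFDerivAt.hasFDerivAt (hcomp.congr_mfderiv (ContinuousLinearMap.ext fun τ =>
    c.mfderiv_coord_eq_zero _ ht _ ((hp t).2 τ)))

variable (E) in
/-- A subset of `X` that meets at most countably many plaques of each foliated chart. -/
def IsTransversallyCountable (S : Set X) : Prop :=
  ∀ c : FoliatedChart E X, (c.coord '' (S ∩ c.source)).Countable

theorem IsTangentMap.isTransversallyCountable_range [SecondCountableTopology P]
    (hp : IsTangentMap E p) : IsTransversallyCountable E (range p) := by
  intro c
  refine (countable_image_of_hasFDerivAt_zero (c.isOpen_source.preimage hp.continuous)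
    fun t ht => c.hasFDerivAt_coord_comp hp ht).mono ?_
  rintro _ ⟨_, ⟨⟨t, rfl⟩, ht⟩, rfl⟩
  exact ⟨t, ht, rfl⟩

end TangentMap

theorem isTransversallyCountable_singleton (x : X) : IsTransversallyCountable E {x} :=
  fun c => ((countable_singleton x).mono inter_subset_left).image c.coord

theorem IsTransversallyCountable.mono {S T : Set X} (hT : IsTransversallyCountable E T)
    (hST : S ⊆ T) : IsTransversallyCountable E S :=
  fun c => (hT c).mono (by gcongr)

theorem isTransversallyCountable_biUnion {ι : Type*} {I : Set ι} (hI : I.Countable)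
    {S : ι → Set X} (hS : ∀ i ∈ I, IsTransversallyCountable E (S i)) :
    IsTransversallyCountable E (⋃ i ∈ I, S i) := by
  intro c
  rw [iUnion₂_inter, image_iUnion₂]
  exact hI.biUnion fun i hi => hS i hi c

namespace FoliatedChart

/-- The union of the plaques of the foliated chart `c` that meet `S`. -/
def saturation (c : FoliatedChart E X) (S : Set X) : Set X :=
  c.source ∩ c.coord ⁻¹' (c.coord '' (S ∩ c.source))

theorem saturation_iUnion {ι : Sort*} (c : FoliatedChart E X) (S : ι → Set X) :
    c.saturation (⋃ i, S i) = ⋃ i, c.saturation (S i) := by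
  simp only [saturation, iUnion_inter, image_iUnion, preimage_iUnion, inter_iUnion]

theorem isTransversallyCountable_saturation (c : FoliatedChart E X) {S : Set X}
    (hS : IsTransversallyCountable E S) : IsTransversallyCountable E (c.saturation S) := by
  have hplaque (w : c.transversal) : IsTransversallyCountable E (c.source ∩ c.coord ⁻¹' {w}) := by
    obtain ⟨n, p, hp, hsub⟩ := c.exists_isTangentMap w
    exact hp.isTransversallyCountable_range.mono hsub
  have heq : c.saturation S = ⋃ w ∈ c.coord '' (S ∩ c.source), c.source ∩ c.coord ⁻¹' {w} := by
    rw [← inter_iUnion₂, ← preimage_iUnion₂, biUnion_of_singleton, saturation]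
  exact heq ▸ isTransversallyCountable_biUnion (hS c) fun w _ => hplaque w

end FoliatedChart

variable {𝓐 : Set (FoliatedChart E X)}

theorem IsTransversallyCountable.exists_saturated_superset {S : Set X}
    (hS : IsTransversallyCountable E S) (h𝓐 : 𝓐.Countable) :
    ∃ T, IsTransversallyCountable E T ∧ S ⊆ T ∧ ∀ c ∈ 𝓐, c.saturation T ⊆ T := by
  let D : ℕ → Set X := fun n => (fun T => ⋃ c ∈ 𝓐, c.saturation T)^[n] S
  have hsucc (n : ℕ) : D (n + 1) = ⋃ c ∈ 𝓐, c.saturation (D n) :=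
    Function.iterate_succ_apply' _ n S
  have hD (n : ℕ) : IsTransversallyCountable E (D n) := by
    induction n with
    | zero => exact hS
    | succ n ih =>
      rw [hsucc]
      exact isTransversallyCountable_biUnion h𝓐 fun c _ => c.isTransversallyCountable_saturation ih
  refine ⟨⋃ n, D n, ?_, subset_iUnion D 0, fun c hc => ?_⟩
  · rw [← biUnion_univ]
    exact isTransversallyCountable_biUnion countable_univ fun n _ => hD n
  · rw [FoliatedChart.saturation_iUnion]
    refine iUnion_subset fun n => ?_
    calc c.saturation (D n) ⊆ ⋃ c ∈ 𝓐, c.saturation (D n) :=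
          subset_biUnion_of_mem (u := fun c : FoliatedChart E X => c.saturation (D n)) hc
      _ = D (n + 1) := (hsucc n).symm
      _ ⊆ ⋃ n, D n := subset_iUnion D (n + 1)

theorem IsTangentMap.mem_iff_of_saturated {P : Type*} [NormedAddCommGroup P] [NormedSpace ℂ P]
    {p : P → X} (hp : IsTangentMap E p) (hcover : ∀ y, ∃ c ∈ 𝓐, y ∈ c.source) {S : Set X}
    (hS : ∀ c ∈ 𝓐, c.saturation S ⊆ S) (s t : P) : p s ∈ S ↔ p t ∈ S := by
  have hconst : IsLocallyConstant fun t => p t ∈ S := by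
    refine (IsLocallyConstant.iff_eventually_eq _).2 fun t₀ => ?_
    obtain ⟨c, hc, ht₀⟩ := hcover (p t₀)
    have hnear : ∀ᶠ t in 𝓝 t₀, p t ∈ c.source :=
      hp.continuous.continuousAt.eventually (c.isOpen_source.mem_nhds ht₀)
    filter_upwards [hnear, eventually_eq_of_hasFDerivAt_zero
      (hnear.mono fun t ht => c.hasFDerivAt_coord_comp hp ht)] with t ht hcoord
    exact propext ⟨fun h => hS c hc ⟨ht₀, p t, ⟨h, ht⟩, hcoord⟩,
      fun h => hS c hc ⟨ht, p t₀, ⟨h, ht₀⟩, hcoord.symm⟩⟩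
  exact iff_of_eq (hconst.apply_eq_of_isPreconnected isPreconnected_univ (mem_univ s) (mem_univ t))

theorem SAutHol.smul_mem_iff_of_saturated (hcover : ∀ y, ∃ c ∈ 𝓐, y ∈ c.source) {S : Set X}
    (hS : ∀ c ∈ 𝓐, c.saturation S ⊆ S) (g : SAutHol E X) (y : X) : g • y ∈ S ↔ y ∈ S := by
  obtain ⟨g, hg⟩ := g
  change g • y ∈ S ↔ y ∈ S
  induction hg using Subgroup.closure_induction generalizing y with
  | mem g hg =>
    obtain ⟨v, hv, φ, hφ, t, hgt⟩ := hg
    have hflow : φ y t ∈ S ↔ φ y 0 ∈ S :=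
      ((⟨v, φ, hv, hφ⟩ : HolomorphicFlow E X).isTangentMap y).mem_iff_of_saturated hcover hS t 0
    rwa [(hφ y).1, ← hgt] at hflow
  | one => rw [one_smul]
  | mul a b _ _ ha hb => rw [mul_smul, ha, hb]
  | inv a _ ha => rw [← ha, smul_inv_smul]

theorem FoliatedChart.countable_coord_image_source [SecondCountableTopology X]
    [MulAction.IsPretransitive (SAutHol E X) X]
    (hcover : ∀ y : X, ∃ c : FoliatedChart E X, y ∈ c.source) (c : FoliatedChart E X) :
    (c.coord '' c.source).Countable := by
  choose a ha using hcover
  obtain ⟨B, hB, hBcover⟩ := TopologicalSpace.countable_cover_nhds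
    fun y => (a y).isOpen_source.mem_nhds (ha y)
  have hcover : ∀ y, ∃ c ∈ a '' B, y ∈ c.source := fun y => by
    simpa using hBcover.symm.subset (mem_univ y)
  rcases c.source.eq_empty_or_nonempty with hempty | ⟨x, -⟩
  · rw [hempty, image_empty]
    exact countable_empty
  obtain ⟨S, hcount, hxS, hS⟩ :=
    (isTransversallyCountable_singleton (E := E) x).exists_saturated_superset (hB.image a)
  have huniv : S = univ := eq_univ_of_forall fun y => by
    obtain ⟨g, rfl⟩ := MulAction.exists_smul_eq (SAutHol E X) x y
    exact (SAutHol.smul_mem_iff_of_saturated hcover hS g x).2 (hxS rfl)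
  simpa only [huniv, univ_inter] using hcount c

end FoliatedChart

section Transversal

theorem snd_eq_zero_of_leftInverse {K T W V : Type*} [DivisionRing K] [AddCommGroup T] [Module K T]
    [AddCommGroup W] [Module K W] [AddCommGroup V] [Module K V]
    {A : T × W →ₗ[K] V} {B : V →ₗ[K] T × W} (hBA : Function.LeftInverse B A) {D : Submodule K V}
    [FiniteDimensional K D] (hA : ∀ τ, A (τ, 0) ∈ D) (hD : Module.finrank K D ≤ Module.finrank K T)
    {w : V} (hw : w ∈ D) : (B w).2 = 0 := by
  let L : T →ₗ[K] V := A ∘ₗ LinearMap.inl K T W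
  have hL : Function.Injective L := hBA.injective.comp LinearMap.inl_injective
  have hrange : LinearMap.range L = D := by
    refine Submodule.eq_of_le_of_finrank_le ?_ (by rwa [LinearMap.finrank_range_of_inj hL])
    rintro _ ⟨τ, rfl⟩
    exact hA τ
  obtain ⟨τ, rfl⟩ := hrange ▸ hw
  exact congrArg Prod.snd (hBA (τ, 0))

variable {E : Type*} [NormedAddCommGroup E] [NormedSpace ℂ E] [FiniteDimensional ℂ E]
  {X : Type*} [TopologicalSpace X] [T2Space X] [ChartedSpace E X] [IsManifold 𝓘(ℂ, E) ω X]
  {x : X}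

section

variable {W : Submodule ℂ E} {ι : Type*} [Fintype ι] {φ : ι → HolomorphicFlow E X}
  {ψ : X → (ι → ℂ) × W}

theorem mfderiv_snd_inverse_flowBox_eq_zero {p : (ι → ℂ) × W}
    (hflowBox : MDifferentiableAt 𝓘(ℂ, (ι → ℂ) × W) 𝓘(ℂ, E) (flowBox x W φ) p)
    (hψ : MDifferentiableAt 𝓘(ℂ, E) 𝓘(ℂ, (ι → ℂ) × W) ψ (flowBox x W φ p))
    (hleft : ∀ᶠ q in 𝓝 p, ψ (flowBox x W φ q) = q)
    (hrank : Module.finrank ℂ (completeSpan E (flowBox x W φ p)) ≤ Fintype.card ι)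
    {w : TangentSpace 𝓘(ℂ, E) (flowBox x W φ p)} (hw : w ∈ completeSpan E (flowBox x W φ p)) :
    mfderiv 𝓘(ℂ, E) 𝓘(ℂ, W) (fun y => (ψ y).2) (flowBox x W φ p) w = 0 := by
  have : CompleteSpace E := FiniteDimensional.complete ℂ E
  let A : (ι → ℂ) × W →L[ℂ] E := mfderiv 𝓘(ℂ, (ι → ℂ) × W) 𝓘(ℂ, E) (flowBox x W φ) p
  let B : E →L[ℂ] (ι → ℂ) × W := mfderiv 𝓘(ℂ, E) 𝓘(ℂ, (ι → ℂ) × W) ψ (flowBox x W φ p)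
  have hBA : Function.LeftInverse B A := by
    have hcomp : HasFDerivAt (ψ ∘ flowBox x W φ) (B ∘L A) p :=
      (hψ.hasMFDerivAt.comp p hflowBox.hasMFDerivAt).hasFDerivAt
    exact DFunLike.congr_fun
      (hcomp.unique ((hasFDerivAt_id (𝕜 := ℂ) p).congr_of_eventuallyEq hleft))
  have hsnd := ((ContinuousLinearMap.snd ℂ (ι → ℂ) W).hasMFDerivAt
    (x := ψ (flowBox x W φ p))).comp (flowBox x W φ p) hψ.hasMFDerivAt
  let D : Submodule ℂ E := completeSpan E (flowBox x W φ p)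
  have hD : Module.finrank ℂ D ≤ Module.finrank ℂ (ι → ℂ) :=
    hrank.trans_eq (Module.finrank_fintype_fun_eq_card ℂ).symm
  exact (DFunLike.congr_fun hsnd.mfderiv w).trans (snd_eq_zero_of_leftInverse
    (A := A.toLinearMap) (B := B.toLinearMap) (D := D) hBA
    (mfderiv_flowBox_mem_completeSpan hflowBox) hD hw)

theorem eventually_mfderiv_snd_inverse_flowBox_eq_zero
    (hψ : ContMDiffAt 𝓘(ℂ, E) 𝓘(ℂ, (ι → ℂ) × W) ω ψ x) (hψ₀ : ψ x = 0)
    (hleft : ∀ᶠ p in 𝓝 0, ψ (flowBox x W φ p) = p)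
    (hright : ∀ᶠ y in 𝓝 x, flowBox x W φ (ψ y) = y)
    (hrank : ∀ᶠ y in 𝓝 x, Module.finrank ℂ (completeSpan E y) ≤ Fintype.card ι) :
    ∀ᶠ y in 𝓝 x, ∀ w ∈ completeSpan E y,
      mfderiv 𝓘(ℂ, E) 𝓘(ℂ, W) (fun y => (ψ y).2) y w = 0 := by
  have : CompleteSpace E := FiniteDimensional.complete ℂ E
  have hflowBox := (contMDiffAt_iff_contMDiffAt_nhds (by simp)).1 (contMDiffAt_flowBox_zero x W φ)
  have htendsto : Tendsto ψ (𝓝 x) (𝓝 0) := hψ₀ ▸ hψ.continuousAt.tendsto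
  filter_upwards [hright, hrank, (contMDiffAt_iff_contMDiffAt_nhds (by simp)).1 hψ,
    htendsto.eventually hflowBox, htendsto.eventually (eventually_eventually_nhds.2 hleft)]
    with y hy hrank hψ hflowBox hleft
  rw [← hy] at hrank hψ
  have hzero := fun w => mfderiv_snd_inverse_flowBox_eq_zero (w := w)
    (hflowBox.mdifferentiableAt (by simp)) (hψ.mdifferentiableAt (by simp)) hleft hrank
  rwa [hy] at hzero

end

theorem exists_foliatedChart (hr : ∀ᶠ y in 𝓝 x,
      Module.finrank ℂ (completeSpan E y) ≤ Module.finrank ℂ (completeSpan E x)) :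
    ∃ c : FoliatedChart E X, x ∈ c.source ∧ IsCompl (completeSpan E x) c.transversal ∧
      c.coord '' c.source ∈ 𝓝 0 := by
  have : CompleteSpace E := FiniteDimensional.complete ℂ E
  obtain ⟨φ, hli, hspan⟩ := exists_flows_spanning_completeSpan E x
  obtain ⟨W, hW⟩ := (Submodule.span ℂ (range (fieldValues φ x))).exists_isCompl
  obtain ⟨ψ, hψ, hψ₀, hleft, hright⟩ := exists_inverse_flowBox hli hW
  have hkernel := eventually_mfderiv_snd_inverse_flowBox_eq_zero hψ hψ₀ hleft hright
    (by simpa only [Fintype.card_fin] using hr)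
  have hsmooth := (contMDiffAt_iff_contMDiffAt_nhds (by simp)).1 hψ
  obtain ⟨U, hU, hUopen, hxU⟩ := eventually_nhds_iff.1 (hright.and (hsmooth.and hkernel))
  let c : FoliatedChart E X :=
    { source := U
      transversal := W
      coord := fun y => (ψ y).2
      isOpen_source := hUopen
      mdifferentiableAt_coord := fun y hy =>
        (ContinuousLinearMap.snd ℂ _ W).hasMFDerivAt.mdifferentiableAt.comp y
          ((hU y hy).2.1.mdifferentiableAt (by simp))
      mfderiv_coord_eq_zero := fun y hy => (hU y hy).2.2
      exists_isTangentMap := fun w => ⟨_, _,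
        isTangentMap_multiFlow φ Finset.univ.toList (chartSlice x W w), by
          rintro y ⟨hy, rfl⟩
          exact ⟨(ψ y).1, (hU y hy).1⟩⟩ }
  exact ⟨c, hxU, hspan ▸ hW, snd_image_mem_nhds_zero_of_inverse_flowBox hleft (hUopen.mem_nhds hxU)⟩

theorem isHolomorphicallyFlexible_of_isPretransitive [SecondCountableTopology X]
    (hX : MulAction.IsPretransitive (SAutHol E X) X) : IsHolomorphicallyFlexible E X := by
  intro x
  have hrank (y z : X) :
      Module.finrank ℂ (completeSpan E y) = Module.finrank ℂ (completeSpan E z) := by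
    obtain ⟨g, rfl⟩ := hX.exists_smul_eq z y
    exact AutHol.finrank_completeSpan_smul (g : AutHol E X) z
  have hchart (y : X) := exists_foliatedChart (.of_forall fun z => (hrank z y).le)
  obtain ⟨c, -, hcompl, hnhds⟩ := hchart x
  have hcount : (c.coord '' c.source).Countable :=
    c.countable_coord_image_source fun y => (hchart y).imp fun _ hc => hc.1
  have hbot : c.transversal = ⊥ := by
    by_contra hne
    have : Nontrivial c.transversal := Submodule.nontrivial_iff_ne_bot.2 hne
    obtain ⟨w, hw, hw'⟩ := (hcount.dense_compl ℂ).inter_nhds_nonempty hnhds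
    exact hw hw'
  exact eq_top_of_isCompl_bot (hbot ▸ hcompl)

end Transversal

theorem mainTheorem4
    {E : Type*} [NormedAddCommGroup E] [NormedSpace ℂ E] [FiniteDimensional ℂ E]
    {X : Type*} [TopologicalSpace X] [T2Space X] [SecondCountableTopology X] [ConnectedSpace X]
    [ChartedSpace E X] [IsManifold 𝓘(ℂ, E) ω X] :
    (MulAction.IsPretransitive (SAutHol E X) X ↔ IsHolomorphicallyFlexible E X) ∧
      (IsHolomorphicallyFlexible E X → MulAction.IsPretransitive (AutHol E X) X) := by
  refine ⟨⟨isHolomorphicallyFlexible_of_isPretransitive, fun hX => hX.isPretransitive_SAutHol⟩,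
    fun hX => ⟨fun x y => ?_⟩⟩
  obtain ⟨g, hg⟩ := hX.isPretransitive_SAutHol.exists_smul_eq x y
  exact ⟨g, hg⟩
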